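/- **Setting.** Let $J\ge 0$ and let $\dot\xi=\mathcal A_j\xi+\mathcal B_ju+\bar d_j$, $j=0,\dots,J$, be the modes of a switched system on $\mathbb R^q$ with input $u\in\mathbb R^m$ (the augmented system). Mode $j$ is active on $[t_j,t_{j+1})$, where $0=t_0<t_1<\dots<t_J$, $t_{J+1}=\infty$ and $t_{j+1}-t_j\ge\omega_j>0$; $\sigma(t)$ denotes the index of the active mode. Let $\mathcal Q,\tilde R_1\succ0$; let $\mathcal P_j^\star\succ0$ solve $\mathcal A_j^\top\mathcal P+\mathcal P\mathcal A_j+\mathcal Q-\mathcal P\mathcal B_j\tilde R_1^{-1}\mathcal B_j^\top\mathcal P=0$, let $\mathcal K_j^\star=\tilde R_1^{-1}\mathcal B_j^\top\mathcal P_j^\star$ be the optimal LQR gain of mode $j$, and let $\xi_j^r$ be given by $(\mathcal A_j-\mathcal B_j\mathcal K_j^\star)\xi_j^r=-\bar d_j$. All vector norms are Euclidean, all matrix norms are spectral norms, and $\mu_2(M)=\lambda_{\max}((M+M^\top)/2)$. **Algorithm.** Fix a delay $\tau>0$, a window length $\delta>0$, an inter-learning interval $\Delta T_\ell>0$ and a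 tolerance $\epsilon>0$, and write $\Delta f(t)=f(t)-f(t-\tau)$. Learning phase $n=0,1,2,\dots$ has sampling instants $\tau_{n,1}\le\dots\le\tau_{n,p_n}$; it begins at $\tau_{n,1}$ and ends at $\tau_{n,p_n}+\delta$. Phase $0$ begins at time $\tau$, and each phase begins $\Delta T_\ell$ after the end of the previous one. Every phase lasts at most $\zeta_{\max}$. Phase $n$ starts from a gain $\mathcal K^{n,0}$, and $\mathcal K^{0,0}=\mathcal K^0$ is a given gain such that $\mathcal A_0-\mathcal B_0\mathcal K^0$ is Hurwitz. Before and during phase $0$ the control is $u=-\mathcal K^0\xi+e_0$, during phase $n$ it is $u=-\mathcal K^{n,0}\xi+e_0$, and between phases $n$ and $n+1$ it is $u=-\mathcal K^{n+1,0}\xi$; the exploration noise $e_0$ is measurable with $\|e_0(t)\|\le\bar e$. Phase $n$ records the matrices $\delta_{\xi\xi},I_{\xi\xi},I_{\xi u}$ whose $i$-th rows are $(\Delta\xi\otimes\Delta\xi)^\top\big|_{\tau_{n,i}}^{\tau_{n,i}+\delta}$, $\int_{\tau_{n,i}}^{\tau_{n,i}+\delta}(\Delta\xi\otimes\Delta\xi)^\top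 dt$ and $\int_{\tau_{n,i}}^{\tau_{n,i}+\delta}(\Delta\xi\otimes\Delta u)^\top dt$. For $k=0,1,2,\dots$, with $K=\mathcal K^{n,k}$, it computes $P=\mathcal P^{n,k}=P^\top$ and $K'=\mathcal K^{n,k+1}$ by solving, exactly or (if the data are inconsistent) in the least-squares sense, $$\delta_{\xi\xi}\operatorname{vec}P-2\big(I_{\xi\xi}(I_q\otimes K^\top\tilde R_1)+I_{\xi u}(I_q\otimes\tilde R_1)\big)\operatorname{vec}K'=-I_{\xi\xi}\operatorname{vec}(\mathcal Q+K^\top\tilde R_1K).$$ If $k\ge1$ is the first index with $\|\mathcal P^{n,k}-\mathcal P^{n,k-1}\|<\epsilon$, the iteration stops and $\mathcal K^{n+1,0}=\mathcal K^{n,k+1}$. Phase $n$ is *clean* for mode $j$ if $[\tau_{n,1}-\tau,\ \tau_{n,p_n}+\delta]$ is contained in $[t_j,t_{j+1}]$, and *mixed* at $t_{j+1}$ if $\tau_{n,1}-\tau<t_{j+1}<\tau_{n,p_n}+\delta$. **Assumptions.** 1. (Rank condition) In every phase $\operatorname{rank}[I_{\xi\xi}\ I_{\xi u}]=\frac{q(q+1)}2+mq$.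 2. (Bounded reference jumps) $\|\xi_j^r-\xi_{j+1}^r\|\le\Delta_r$ for $0\le j<J$, where $\Delta_r\ge0$. 3. (Logarithmic-norm margins) There are $\gamma_j>0$ $(0\le j\le J)$, $\rho_j\ge0$ $(0\le j<J)$ and $\bar B>0$ with $\mu_2(\mathcal A_j-\mathcal B_j\mathcal K_j^\star)\le-\gamma_j$, $\|(\mathcal A_{j+1}-\mathcal A_j)-(\mathcal B_{j+1}-\mathcal B_j)\mathcal K_j^\star\|\le\rho_j<\gamma_j$ and $\|\mathcal B_{j+1}\|\le\bar B$. Whenever phase $n$ is mixed at $t_{j+1}$, the resulting gain satisfies $\|\mathcal K^{n+1,0}-\mathcal K_j^\star\|<(\gamma_j-\rho_j)/\bar B$. Put $\omega_{\min}=\min_j\omega_j$ and $\gamma_{\min}=\min_j\gamma_j$. **Theorem.** Suppose that $\Delta T_\ell<\omega_{\min}-\frac{\ln(2\nu)}{\gamma_{\min}}-2\zeta_{\max}$ for some $\nu\ge1$, and that the delay is short in comparison with the dwell times, $\tau+\Delta T_\ell+2\zeta_{\max}\le\omega_{\min}$. Then there are constants $\epsilon_0>0$, $c_1>0$, $c_2\ge0$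 and $\alpha>0$, independent of the switching instants, the sampling instants, the exploration noise (other than through $\bar e$) and the trajectory, such that the following holds for every tolerance $0<\epsilon\le\epsilon_0$ and every closed-loop run under Assumptions 1–3. * For each $j=0,\dots,J$ there is a learning phase that is clean for mode $j$, and in every such phase $n$ the generated gains satisfy $\mathcal K^{n,k}\to\mathcal K_j^\star$ as $k\to\infty$. * For all $t\ge0$, $\ \|\xi(t)-\xi^r_{\sigma(t)}\|\le c_1e^{-\alpha t}\|\xi(0)-\xi^r_{\sigma(0)}\|+c_2$. -/

import Mathlib

open Filter
open scoped Matrix Kronecker Topology Matrix.Norms.L2Operator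

noncomputable section

namespace OffPolicy

/-- The Euclidean norm of a coordinate vector. (Matrices carry the norm `‖·‖₂`, the operator norm
for Euclidean norms, through the scope `Matrix.Norms.L2Operator`.) -/
def euclNorm {ι : Type*} [Fintype ι] (v : ι → ℝ) : ℝ := ‖WithLp.toLp 2 v‖

/-- The logarithmic norm `μ₂(M) = λ_max ((M + Mᵀ) / 2)`. -/
def logNorm {q : ℕ} (M : Matrix (Fin q) (Fin q) ℝ) : ℝ :=
  sSup (spectrum ℝ ((1 / 2 : ℝ) • (M + Mᵀ)))

/-- All complex eigenvalues have negative real part. -/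
def IsHurwitz {q : ℕ} (M : Matrix (Fin q) (Fin q) ℝ) : Prop :=
  ∀ z ∈ spectrum ℂ (M.map (algebraMap ℝ ℂ)), z.re < 0

/-- One mode of the switched system `ξ' = A ξ + B u + d`. -/
structure Mode (q m : ℕ) where
  A : Matrix (Fin q) (Fin q) ℝ
  B : Matrix (Fin q) (Fin m) ℝ
  d : Fin q → ℝ

/-- The closed-loop matrix under `u = -K ξ`. -/
def Mode.closedLoop {q m : ℕ} (M : Mode q m) (K : Matrix (Fin m) (Fin q) ℝ) :
    Matrix (Fin q) (Fin q) ℝ :=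
  M.A - M.B * K

/-- `P` is the symmetric positive definite solution of the algebraic Riccati equation of the mode
for the state weight `Q` and the control weight `R`. -/
structure IsRiccatiSolution {q m : ℕ} (M : Mode q m) (Q : Matrix (Fin q) (Fin q) ℝ)
    (R : Matrix (Fin m) (Fin m) ℝ) (P : Matrix (Fin q) (Fin q) ℝ) : Prop where
  posDef : P.PosDef
  riccati : M.Aᵀ * P + P * M.A + Q - P * M.B * R⁻¹ * M.Bᵀ * P = 0

/-- The gain `R⁻¹ Bᵀ P`; it is the optimal gain of the mode when `P` solves the Riccati equation. -/
def Mode.gain {q m : ℕ} (M : Mode q m) (R : Matrix (Fin m) (Fin m) ℝ)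
    (P : Matrix (Fin q) (Fin q) ℝ) : Matrix (Fin m) (Fin q) ℝ :=
  R⁻¹ * M.Bᵀ * P

/-- The index of the mode that is active at time `t`, for switching times `T 0 < ⋯ < T J`:
the largest `j` with `T j ≤ t`. -/
def activeMode {J : ℕ} (T : Fin (J + 1) → ℝ) (t : ℝ) : Fin (J + 1) :=
  (Finset.univ.filter fun j => T j ≤ t).sup id

/-- The sampling instants of the learning phases: in phase `n = 0, 1, 2, …` data are recorded on
the windows `[start n i, start n i + δ]`, `i = 0, …, p n`. -/
structure Schedule where
  p : ℕ → ℕ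
  start : ∀ n, Fin (p n + 1) → ℝ

/-- The time at which learning phase `n` begins. -/
def Schedule.begins (S : Schedule) (n : ℕ) : ℝ := S.start n 0

/-- The time at which learning phase `n` finishes. -/
def Schedule.finishes (S : Schedule) (δ : ℝ) (n : ℕ) : ℝ := S.start n (Fin.last _) + δ

/-- Time-triggered periodic learning: the first phase begins at time `τ`, and each phase is
followed by an inter-learning interval of length `ΔT`. No phase lasts longer than `ζ`. -/
structure Schedule.IsPeriodic (S : Schedule) (τ δ ΔT ζ : ℝ) : Prop where
  mono : ∀ n, Monotone (S.start n)
  first : S.begins 0 = τ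
  next : ∀ n, S.begins (n + 1) = S.finishes δ n + ΔT
  duration_le : ∀ n, S.finishes δ n - S.begins n ≤ ζ

/-- The data of phase `n` (including the delayed samples) come from mode `j` only. -/
def Schedule.IsClean {J : ℕ} (S : Schedule) (τ δ : ℝ) (T : Fin (J + 1) → ℝ) (n : ℕ)
    (j : Fin (J + 1)) : Prop :=
  T j ≤ S.begins n - τ ∧ ∀ i, j < i → S.finishes δ n ≤ T i

/-- The data of phase `n` (including the delayed samples) straddle the switch from mode `j` to
mode `j + 1`. -/
def Schedule.IsMixed {J : ℕ} (S : Schedule) (τ δ : ℝ) (T : Fin (J + 1) → ℝ) (n : ℕ)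
    (j : Fin J) : Prop :=
  S.begins n - τ < T j.succ ∧ T j.succ < S.finishes δ n

/-- The increment `f t - f (t - τ)`. -/
def incr {ι : Type*} (τ : ℝ) (f : ℝ → ι → ℝ) (t : ℝ) : ι → ℝ := f t - f (t - τ)

/-- The data matrices `δ_ξξ`, `I_ξξ` and `I_ξu` of one learning phase, with one row per window. -/
structure Data (p q m : ℕ) where
  dXX : Matrix (Fin (p + 1)) (Fin q × Fin q) ℝ
  iXX : Matrix (Fin (p + 1)) (Fin q × Fin q) ℝ
  iXU : Matrix (Fin (p + 1)) (Fin q × Fin m) ℝ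

/-- The data recorded in phase `n` along the state `ξ` and the input `u`. -/
def Schedule.data {q m : ℕ} (S : Schedule) (τ δ : ℝ) (ξ : ℝ → Fin q → ℝ) (u : ℝ → Fin m → ℝ)
    (n : ℕ) : Data (S.p n) q m where
  dXX := Matrix.of fun i ab =>
    incr τ ξ (S.start n i + δ) ab.1 * incr τ ξ (S.start n i + δ) ab.2
      - incr τ ξ (S.start n i) ab.1 * incr τ ξ (S.start n i) ab.2
  iXX := Matrix.of fun i ab =>
    ∫ t in (S.start n i)..(S.start n i + δ), incr τ ξ t ab.1 * incr τ ξ t ab.2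
  iXU := Matrix.of fun i ab =>
    ∫ t in (S.start n i)..(S.start n i + δ), incr τ ξ t ab.1 * incr τ u t ab.2

/-- The rank condition `rank [I_ξξ  I_ξu] = q (q + 1) / 2 + m q`. -/
def Data.RankCondition {p q m : ℕ} (D : Data p q m) : Prop :=
  (Matrix.fromCols D.iXX D.iXU).rank = q * (q + 1) / 2 + m * q

/-- The matrix `Θ` of the learning equation for the current gain `K`. -/
def Data.theta {p q m : ℕ} (D : Data p q m) (R : Matrix (Fin m) (Fin m) ℝ)
    (K : Matrix (Fin m) (Fin q) ℝ) :
    Matrix (Fin (p + 1)) (Fin q × Fin q ⊕ Fin q × Fin m) ℝ :=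
  Matrix.fromCols D.dXX
    (-(2 : ℝ) • (D.iXX * ((1 : Matrix (Fin q) (Fin q) ℝ) ⊗ₖ (Kᵀ * R)))
      - (2 : ℝ) • (D.iXU * ((1 : Matrix (Fin q) (Fin q) ℝ) ⊗ₖ R)))

/-- The right-hand side `Ξ` of the learning equation for the current gain `K`. -/
def Data.xi {p q m : ℕ} (D : Data p q m) (Q : Matrix (Fin q) (Fin q) ℝ)
    (R : Matrix (Fin m) (Fin m) ℝ) (K : Matrix (Fin m) (Fin q) ℝ) : Fin (p + 1) → ℝ :=
  -(D.iXX *ᵥ Matrix.vec (Q + Kᵀ * R * K))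

/-- The residual of the learning equation `Θ [vec P; vec K'] = Ξ`. -/
def Data.residual {p q m : ℕ} (D : Data p q m) (Q : Matrix (Fin q) (Fin q) ℝ)
    (R : Matrix (Fin m) (Fin m) ℝ) (K : Matrix (Fin m) (Fin q) ℝ)
    (P : Matrix (Fin q) (Fin q) ℝ) (K' : Matrix (Fin m) (Fin q) ℝ) : Fin (p + 1) → ℝ :=
  D.theta R K *ᵥ Sum.elim (Matrix.vec P) (Matrix.vec K') - D.xi Q R K

/-- `(P, K')`, with `P` symmetric, solves the learning equation for the current gain `K` in the
least-squares sense. Whenever the equation has an exact solution with symmetric `P`, these are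
precisely its exact solutions; data from two different modes may be inconsistent. -/
def Data.IsSolution {p q m : ℕ} (D : Data p q m) (Q : Matrix (Fin q) (Fin q) ℝ)
    (R : Matrix (Fin m) (Fin m) ℝ) (K : Matrix (Fin m) (Fin q) ℝ)
    (P : Matrix (Fin q) (Fin q) ℝ) (K' : Matrix (Fin m) (Fin q) ℝ) : Prop :=
  P.IsSymm ∧ ∀ (P₁ : Matrix (Fin q) (Fin q) ℝ) (K₁ : Matrix (Fin m) (Fin q) ℝ), P₁.IsSymm →
    euclNorm (D.residual Q R K P K') ≤ euclNorm (D.residual Q R K P₁ K₁)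

/-- The iteration stops after `P (k + 1)` has been computed: this is the first time that two
successive value matrices differ by less than `ε`. -/
def StopsAt {q : ℕ} (P : ℕ → Matrix (Fin q) (Fin q) ℝ) (ε : ℝ) (k : ℕ) : Prop :=
  ‖P (k + 1) - P k‖ < ε ∧ ∀ i < k, ε ≤ ‖P (i + 1) - P i‖

/-- A run of the periodic off-policy algorithm in closed loop with the switched system.
`P n k` and `K n k` are the iterates of learning phase `n`; `K n 0` is the gain with which phase `n`
starts, so `K (n + 1) 0` is the gain applied after phase `n`. -/
structure IsRun {q m J : ℕ} (modes : Fin (J + 1) → Mode q m) (Q : Matrix (Fin q) (Fin q) ℝ)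
    (R : Matrix (Fin m) (Fin m) ℝ) (K₀ : Matrix (Fin m) (Fin q) ℝ) (T : Fin (J + 1) → ℝ)
    (S : Schedule) (τ δ ε : ℝ) (e : ℝ → Fin m → ℝ) (ξ : ℝ → Fin q → ℝ) (u : ℝ → Fin m → ℝ)
    (P : ℕ → ℕ → Matrix (Fin q) (Fin q) ℝ) (K : ℕ → ℕ → Matrix (Fin m) (Fin q) ℝ) : Prop where
  continuousOn : ContinuousOn ξ (Set.Ici 0)
  dynamics : ∀ t, 0 ≤ t →
    HasDerivWithinAt ξ
      ((modes (activeMode T t)).A *ᵥ ξ t + (modes (activeMode T t)).B *ᵥ u t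
        + (modes (activeMode T t)).d)
      (Set.Ici t) t
  control_warmup : ∀ t, 0 ≤ t → t < S.begins 0 → u t = -(K₀ *ᵥ ξ t) + e t
  control_learning : ∀ n t, S.begins n ≤ t → t < S.finishes δ n → u t = -(K n 0 *ᵥ ξ t) + e t
  control_post : ∀ n t, S.finishes δ n ≤ t → t < S.begins (n + 1) → u t = -(K (n + 1) 0 *ᵥ ξ t)
  initial_gain : K 0 0 = K₀
  iterate : ∀ n k, (S.data τ δ ξ u n).IsSolution Q R (K n k) (P n k) (K n (k + 1))
  handover : ∀ n k, StopsAt (P n) ε k → K (n + 1) 0 = K n (k + 2)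

end OffPolicy

end

open OffPolicy

/-!
The windows of the learning equation turn one trajectory into linear constraints. On data from a
single mode the increments `Δξ` obey `ξ' = A ξ + B u` without the offset `d`, so the product rule,
integrated over a window, makes the residual of the learning equation equal to
`tr (G Y) + 2 tr (H Z)`, where `G`, `H` are the recorded Gram matrices and `Y`, `Z` are the defects
of the Lyapunov equation for `P` and of the relation `R K' = Bᵀ P`
(`Data.IsGeneratedBy.residual_eq`). The rank condition says exactly that the data separate the pairs
`(Y, Z)` with `Y` symmetric (`Data.RankCondition.eq_zero`). Hence a clean phase that starts from a
stabilizing gain performs policy iteration for its mode, and the least-squares solution is exact.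

Stability is carried through the argument by quadratic Lyapunov functions
(`HasLyapunovCertificate`). The comparison principle `HasLyapunovCertificate.posSemidef` gives
existence and uniqueness for Lyapunov equations, monotonicity of policy iteration, and a quadratic
a posteriori bound: a step of size `‖P' - P‖` in the value matrix bounds the distance of `P'` from
the Riccati solution by a multiple of `‖P' - P‖ ^ 2` that depends on the mode only
(`IsPolicyStep.norm_sub_optimal_le_sq`). Since the traces decrease, the steps tend to zero. The
quadratic bound therefore gives both the convergence of the gains and the tolerance `ε₀` that
makes the gain handed over by any clean phase as accurate as needed, whatever its initial gain.

A phase that is clean for mode `j` is preceded by a phase that is clean for `j`, or mixed at the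
switch to `j`, or clean for `j - 1`. In each case the gain it starts from stabilizes mode `j`: by
policy iteration, by the logarithmic-norm margin, or by the margin together with the choice of `ε₀`
(`IsRun.certificate_of_isClean`). Phase `0` starts from the given Hurwitz gain, which has a Lyapunov
function by a Cayley transform and Gelfand's formula (`IsHurwitz.hasLyapunovCertificate`). The
delay condition leaves room for a clean phase in each dwell interval.

At a time at least `τ + ΔT + 2 ζ` after a switch, the gain in use comes from a clean phase, and the
deviation from the steady state decays at a uniform rate. Before that time all gains lie in a fixed
ball, so the deviation grows by at most a fixed factor and a fixed amount
(`euclNorm_le_of_transient`). There are only `J` switches, each of which shifts the steady state by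
at most `Δr`, so these estimates combine to the claimed bound (`le_of_mode_estimates`).
-/

/-! ### Quadratic forms -/

section Quadratic

variable {q m : ℕ}

theorem dotProduct_transpose_mulVec_self (M : Matrix (Fin q) (Fin q) ℝ) (x : Fin q → ℝ) :
    x ⬝ᵥ Mᵀ *ᵥ x = x ⬝ᵥ M *ᵥ x := by
  rw [Matrix.mulVec_transpose, dotProduct_comm, ← Matrix.dotProduct_mulVec]

theorem euclNorm_nonneg {ι : Type*} [Fintype ι] (v : ι → ℝ) : 0 ≤ euclNorm v := norm_nonneg _

theorem euclNorm_sq {ι : Type*} [Fintype ι] (v : ι → ℝ) : euclNorm v ^ 2 = v ⬝ᵥ v := by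
  rw [euclNorm, EuclideanSpace.norm_sq_eq]
  simp [dotProduct, pow_two]

theorem euclNorm_add_le {ι : Type*} [Fintype ι] (v w : ι → ℝ) :
    euclNorm (v + w) ≤ euclNorm v + euclNorm w := by
  simpa [euclNorm] using norm_add_le (WithLp.toLp 2 v) (WithLp.toLp 2 w)

theorem euclNorm_neg {ι : Type*} [Fintype ι] (v : ι → ℝ) : euclNorm (-v) = euclNorm v := by
  simp [euclNorm]

theorem euclNorm_mulVec_le {ι κ : Type*} [Fintype ι] [Fintype κ] [DecidableEq κ]
    (M : Matrix ι κ ℝ) (v : κ → ℝ) : euclNorm (M *ᵥ v) ≤ ‖M‖ * euclNorm v :=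
  Matrix.l2_opNorm_mulVec M (WithLp.toLp 2 v)

theorem dotProduct_le_euclNorm {ι : Type*} [Fintype ι] (v w : ι → ℝ) :
    v ⬝ᵥ w ≤ euclNorm v * euclNorm w := by
  have := real_inner_le_norm (WithLp.toLp 2 w) (WithLp.toLp 2 v)
  rw [EuclideanSpace.inner_eq_star_dotProduct] at this
  simpa [euclNorm, mul_comm] using this

theorem dotProduct_mulVec_le {M : Matrix (Fin q) (Fin q) ℝ} (x : Fin q → ℝ) :
    x ⬝ᵥ M *ᵥ x ≤ ‖M‖ * (x ⬝ᵥ x) := by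
  have h1 := dotProduct_le_euclNorm x (M *ᵥ x)
  have h2 := euclNorm_mulVec_le M x
  rw [← euclNorm_sq]
  nlinarith [euclNorm_nonneg x]

theorem posSemidef_iff_real {M : Matrix (Fin q) (Fin q) ℝ} :
    M.PosSemidef ↔ M.IsSymm ∧ ∀ x, 0 ≤ x ⬝ᵥ M *ᵥ x := by
  rw [Matrix.posSemidef_iff_dotProduct_mulVec]
  simp [Matrix.IsHermitian, Matrix.IsSymm]

theorem Matrix.PosSemidef.isSymm_real {M : Matrix (Fin q) (Fin q) ℝ} (h : M.PosSemidef) :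
    M.IsSymm := (posSemidef_iff_real.1 h).1

theorem Matrix.PosDef.isSymm_real {M : Matrix (Fin q) (Fin q) ℝ} (h : M.PosDef) :
    M.IsSymm := h.posSemidef.isSymm_real

theorem Matrix.PosDef.dotProduct_pos_real {M : Matrix (Fin q) (Fin q) ℝ} (h : M.PosDef)
    {x : Fin q → ℝ} (hx : x ≠ 0) : 0 < x ⬝ᵥ M *ᵥ x := by
  simpa using h.dotProduct_mulVec_pos hx

theorem posSemidef_transpose_mul_mul {W : Matrix (Fin m) (Fin m) ℝ} (hW : W.PosSemidef)
    (K : Matrix (Fin m) (Fin q) ℝ) : (Kᵀ * W * K).PosSemidef := by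
  simpa using hW.conjTranspose_mul_mul_same K

theorem posSemidef_transpose_mul_self (K : Matrix (Fin m) (Fin q) ℝ) :
    (Kᵀ * K).PosSemidef := by
  simpa using Matrix.posSemidef_conjTranspose_mul_self K

/-- The spectral norm of a positive semidefinite matrix is at most any constant that bounds its
quadratic form. -/
theorem norm_le_of_posSemidef {X : Matrix (Fin q) (Fin q) ℝ} {c : ℝ} (hc : 0 ≤ c)
    (hX : X.PosSemidef) (h : ∀ x, x ⬝ᵥ X *ᵥ x ≤ c * (x ⬝ᵥ x)) : ‖X‖ ≤ c := by
  obtain ⟨M, rfl⟩ : ∃ M : Matrix (Fin q) (Fin q) ℝ, X = Mᴴ * M := by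
    open scoped MatrixOrder in
    exact CStarAlgebra.nonneg_iff_eq_star_mul_self.1 (Matrix.nonneg_iff_posSemidef.2 hX)
  rw [Matrix.l2_opNorm_conjTranspose_mul_self]
  have : ‖M‖ ≤ √c := by
    rw [Matrix.l2_opNorm_def]
    refine ContinuousLinearMap.opNorm_le_bound _ (Real.sqrt_nonneg _) fun v => ?_
    refine le_of_sq_le_sq ?_ (by positivity)
    have h1 := h v.ofLp
    rw [mul_pow, Real.sq_sqrt hc]
    have e1 : v.ofLp ⬝ᵥ (Mᴴ * M) *ᵥ v.ofLp = euclNorm (M *ᵥ v.ofLp) ^ 2 := by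
      rw [euclNorm_sq, ← Matrix.mulVec_mulVec, Matrix.dotProduct_mulVec]
      simp [Matrix.vecMul_transpose]
    rw [e1, ← euclNorm_sq] at h1
    exact h1
  calc ‖M‖ * ‖M‖ ≤ √c * √c := by gcongr
    _ = c := Real.mul_self_sqrt hc

theorem norm_le_trace_of_posSemidef {X : Matrix (Fin q) (Fin q) ℝ} (hX : X.PosSemidef) :
    ‖X‖ ≤ X.trace := by
  refine norm_le_of_posSemidef hX.trace_nonneg hX fun x => ?_
  obtain ⟨M, rfl⟩ : ∃ M : Matrix (Fin q) (Fin q) ℝ, X = Mᴴ * M := by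
    open scoped MatrixOrder in
    exact CStarAlgebra.nonneg_iff_eq_star_mul_self.1 (Matrix.nonneg_iff_posSemidef.2 hX)
  have e1 : x ⬝ᵥ (Mᴴ * M) *ᵥ x = (M *ᵥ x) ⬝ᵥ (M *ᵥ x) := by
    rw [← Matrix.mulVec_mulVec, Matrix.dotProduct_mulVec]
    simp [Matrix.vecMul_transpose]
  have e2 : (Mᴴ * M).trace = ∑ i, ∑ j, M i j ^ 2 := by
    rw [Finset.sum_comm]
    simp [Matrix.trace, Matrix.mul_apply, pow_two]
  rw [e1, e2, dotProduct, Finset.sum_mul]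
  refine Finset.sum_le_sum fun i _ => ?_
  rw [← pow_two]
  simpa [dotProduct, Matrix.mulVec, pow_two] using
    Finset.sum_mul_sq_le_sq_mul_sq Finset.univ (fun j => M i j) x

open scoped Pointwise in
/-- The logarithmic norm bounds the quadratic form. -/
theorem dotProduct_mulVec_le_logNorm (M : Matrix (Fin q) (Fin q) ℝ) (x : Fin q → ℝ) :
    x ⬝ᵥ M *ᵥ x ≤ logNorm M * (x ⬝ᵥ x) := by
  set H : Matrix (Fin q) (Fin q) ℝ := (1 / 2 : ℝ) • (M + Mᵀ) with hH
  have hHs : H.IsHermitian := by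
    simp [Matrix.IsHermitian, hH, add_comm]
  have hbdd : BddAbove (spectrum ℝ H) := by
    rw [hHs.spectrum_real_eq_range_eigenvalues]
    exact (Set.finite_range _).bddAbove
  set N : Matrix (Fin q) (Fin q) ℝ := algebraMap ℝ _ (logNorm M) - H with hN
  have hNs : N.IsHermitian := by
    refine Matrix.IsHermitian.sub ?_ hHs
    simp [Matrix.IsHermitian, Algebra.algebraMap_eq_smul_one]
  have hpsd : N.PosSemidef := by
    rw [hNs.posSemidef_iff_eigenvalues_nonneg]
    intro i
    have hsp : spectrum ℝ N = ({logNorm M} : Set ℝ) - spectrum ℝ H := by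
      rw [hN, spectrum.singleton_sub_eq]
    have := hNs.eigenvalues_mem_spectrum_real i
    rw [hsp] at this
    obtain ⟨a, ha, b, hb, hab⟩ := Set.mem_sub.1 this
    rw [Set.mem_singleton_iff] at ha
    have := le_csSup hbdd hb
    simp only [Pi.zero_apply]
    rw [← hab, ha]
    exact sub_nonneg.2 this
  have h := (posSemidef_iff_real.1 hpsd).2 x
  rw [hN, Matrix.sub_mulVec, dotProduct_sub, hH, Matrix.smul_mulVec, Matrix.add_mulVec,
    dotProduct_smul, dotProduct_add, dotProduct_transpose_mulVec_self,
    Algebra.algebraMap_eq_smul_one, Matrix.smul_mulVec, Matrix.one_mulVec, dotProduct_smul] at h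
  simp only [smul_eq_mul] at h
  linarith

end Quadratic

/-! ### Lyapunov operators -/

section Lyapunov

variable {q : ℕ}

/-- The Lyapunov operator `P ↦ Aᵀ P + P A` of a matrix `A`. -/
def lyapunov (A P : Matrix (Fin q) (Fin q) ℝ) : Matrix (Fin q) (Fin q) ℝ := Aᵀ * P + P * A

/-- Stability of `A`, expressed by the existence of a strict quadratic Lyapunov function. -/
def HasLyapunovCertificate (A : Matrix (Fin q) (Fin q) ℝ) : Prop :=
  ∃ Y : Matrix (Fin q) (Fin q) ℝ, Y.PosDef ∧ (-lyapunov A Y).PosDef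

theorem lyapunov_neg (A P : Matrix (Fin q) (Fin q) ℝ) : lyapunov A (-P) = -lyapunov A P := by
  simp [lyapunov, add_comm]

theorem lyapunov_sub (A P P' : Matrix (Fin q) (Fin q) ℝ) :
    lyapunov A (P - P') = lyapunov A P - lyapunov A P' := by
  simp only [lyapunov]; noncomm_ring

theorem dotProduct_lyapunov (A P : Matrix (Fin q) (Fin q) ℝ) (hP : P.IsSymm) (x : Fin q → ℝ) :
    x ⬝ᵥ lyapunov A P *ᵥ x = 2 * ((A *ᵥ x) ⬝ᵥ (P *ᵥ x)) := by
  have h1 : x ⬝ᵥ (Aᵀ * P) *ᵥ x = (A *ᵥ x) ⬝ᵥ (P *ᵥ x) := by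
    rw [← Matrix.mulVec_mulVec, Matrix.dotProduct_mulVec, Matrix.vecMul_transpose]
  have h2 : P * A = (Aᵀ * P)ᵀ := by
    rw [Matrix.transpose_mul, hP.eq, Matrix.transpose_transpose]
  rw [lyapunov, Matrix.add_mulVec, dotProduct_add, h2, dotProduct_transpose_mulVec_self, h1]
  ring

/-- The comparison principle for Lyapunov operators. If `x` minimizes `xᵀPx / xᵀYx` for a
certificate `Y`, with minimum `μ`, then `P x = μ Y x`, so the two Lyapunov operators have
proportional quadratic forms at `x`, which fixes the sign of `μ`. -/
theorem HasLyapunovCertificate.posSemidef {A P : Matrix (Fin q) (Fin q) ℝ}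
    (hA : HasLyapunovCertificate A) (hP : P.IsSymm) (h : (-lyapunov A P).PosSemidef) :
    P.PosSemidef := by
  obtain ⟨Y, hY, hYA⟩ := hA
  refine posSemidef_iff_real.2 ⟨hP, ?_⟩
  by_contra! hneg
  obtain ⟨x₀, hx₀⟩ := hneg
  have hx₀0 : x₀ ≠ 0 := by rintro rfl; simp at hx₀
  have hne : (Metric.sphere (0 : Fin q → ℝ) 1).Nonempty :=
    ⟨‖x₀‖⁻¹ • x₀, by simp [norm_smul, hx₀0]⟩
  have hpos : ∀ x ∈ Metric.sphere (0 : Fin q → ℝ) 1, 0 < x ⬝ᵥ Y *ᵥ x := fun x hx =>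
    hY.dotProduct_pos_real (by rintro rfl; simp at hx)
  have hcont : ContinuousOn (fun x : Fin q → ℝ => (x ⬝ᵥ P *ᵥ x) / (x ⬝ᵥ Y *ᵥ x))
      (Metric.sphere 0 1) := by
    refine ContinuousOn.div ?_ ?_ fun x hx => (hpos x hx).ne' <;>
    exact (continuous_id.dotProduct (continuous_const.matrix_mulVec continuous_id)).continuousOn
  obtain ⟨v, hv, hmin⟩ := (isCompact_sphere (0 : Fin q → ℝ) 1).exists_isMinOn hne hcont
  set μ := (v ⬝ᵥ P *ᵥ v) / (v ⬝ᵥ Y *ᵥ v) with hμ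
  have hv0 : v ≠ 0 := by rintro rfl; simp at hv
  have hall : ∀ x, 0 ≤ x ⬝ᵥ (P - μ • Y) *ᵥ x := by
    intro x
    by_cases hx : x = 0
    · simp [hx]
    have hxn : 0 < ‖x‖ := norm_pos_iff.2 hx
    have h1 : μ ≤ _ := hmin (show ‖x‖⁻¹ • x ∈ Metric.sphere 0 1 by simp [norm_smul, hx])
    have h2 : 0 < x ⬝ᵥ Y *ᵥ x := hY.dotProduct_pos_real hx
    simp only [Matrix.mulVec_smul, dotProduct_smul, smul_dotProduct, smul_eq_mul] at h1
    rw [mul_div_mul_left _ _ (by positivity), mul_div_mul_left _ _ (by positivity),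
      le_div_iff₀ h2] at h1
    rw [Matrix.sub_mulVec, dotProduct_sub, Matrix.smul_mulVec, dotProduct_smul, smul_eq_mul]
    linarith
  have hpsd : (P - μ • Y).PosSemidef := posSemidef_iff_real.2
    ⟨by simp [Matrix.IsSymm, hP.eq, hY.isSymm_real.eq], hall⟩
  have hzero : v ⬝ᵥ (P - μ • Y) *ᵥ v = 0 := by
    rw [Matrix.sub_mulVec, dotProduct_sub, Matrix.smul_mulVec, dotProduct_smul, smul_eq_mul, hμ,
      div_mul_cancel₀ _ (hpos v hv).ne', sub_self]
  have hker : P *ᵥ v = μ • (Y *ᵥ v) := by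
    have := (hpsd.dotProduct_mulVec_zero_iff v).1 (by simpa using hzero)
    rw [Matrix.sub_mulVec, Matrix.smul_mulVec, sub_eq_zero] at this
    exact this
  have h3 := (posSemidef_iff_real.1 h).2 v
  have h4 := hYA.dotProduct_pos_real hv0
  rw [Matrix.neg_mulVec, dotProduct_neg, dotProduct_lyapunov _ _ hP, hker, dotProduct_smul,
    smul_eq_mul] at h3
  rw [Matrix.neg_mulVec, dotProduct_neg, dotProduct_lyapunov _ _ hY.isSymm_real] at h4
  have hμ0 : 0 ≤ μ := by
    by_contra! hlt
    nlinarith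
  have h5 := hall x₀
  rw [Matrix.sub_mulVec, dotProduct_sub, Matrix.smul_mulVec, dotProduct_smul, smul_eq_mul] at h5
  have h6 := hY.dotProduct_pos_real hx₀0
  nlinarith

theorem eq_zero_of_posSemidef_of_neg {P : Matrix (Fin q) (Fin q) ℝ} (h1 : P.PosSemidef)
    (h2 : (-P).PosSemidef) : P = 0 := by
  have h : ∀ x, P *ᵥ x = 0 := fun x => by
    rw [← h1.dotProduct_mulVec_zero_iff]
    have a := (posSemidef_iff_real.1 h1).2 x
    have b := (posSemidef_iff_real.1 h2).2 x
    rw [Matrix.neg_mulVec, dotProduct_neg] at b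
    simpa using le_antisymm (by linarith) a
  exact Matrix.ext_of_mulVec_single fun i => by rw [h, Matrix.zero_mulVec]

theorem HasLyapunovCertificate.eq_zero {A P : Matrix (Fin q) (Fin q) ℝ}
    (hA : HasLyapunovCertificate A) (hP : P.IsSymm) (h : lyapunov A P = 0) : P = 0 := by
  refine eq_zero_of_posSemidef_of_neg (hA.posSemidef hP ?_) (hA.posSemidef ?_ ?_)
  · rw [h, neg_zero]; exact .zero
  · simp [Matrix.IsSymm, hP.eq]
  · rw [lyapunov_neg, h, neg_zero, neg_zero]; exact .zero

/-- Lyapunov equations are uniquely solvable, so that they are solvable. -/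
theorem HasLyapunovCertificate.exists_solution {A W : Matrix (Fin q) (Fin q) ℝ}
    (hA : HasLyapunovCertificate A) (hW : W.IsSymm) :
    ∃ P : Matrix (Fin q) (Fin q) ℝ, P.IsSymm ∧ lyapunov A P = W := by
  let V : Submodule ℝ (Matrix (Fin q) (Fin q) ℝ) :=
    { carrier := {P | P.IsSymm}
      add_mem' := fun ha hb => Matrix.IsSymm.add ha hb
      zero_mem' := Matrix.isSymm_zero
      smul_mem' := fun c _ h => Matrix.IsSymm.smul h c }
  let L : Matrix (Fin q) (Fin q) ℝ →ₗ[ℝ] Matrix (Fin q) (Fin q) ℝ :=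
    { toFun := lyapunov A
      map_add' := fun P P' => by simp only [lyapunov]; noncomm_ring
      map_smul' := fun c P => by simp [lyapunov] }
  have hL : ∀ P ∈ V, L P ∈ V := fun P (hP : P.IsSymm) => by
    change (lyapunov A P).IsSymm
    simp [Matrix.IsSymm, lyapunov, hP.eq, add_comm]
  have hinj : Function.Injective (L.restrict hL) := by
    rw [injective_iff_map_eq_zero]
    rintro ⟨P, hP⟩ h
    exact Subtype.ext (hA.eq_zero hP (congrArg Subtype.val h))
  obtain ⟨⟨P, hP⟩, h⟩ := LinearMap.injective_iff_surjective.1 hinj ⟨W, hW⟩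
  exact ⟨P, hP, congrArg Subtype.val h⟩

/-- A negative definite quadratic form is certified by the identity matrix. -/
theorem hasLyapunovCertificate_of_form_neg {A : Matrix (Fin q) (Fin q) ℝ}
    (h : ∀ x, x ≠ 0 → x ⬝ᵥ A *ᵥ x < 0) : HasLyapunovCertificate A := by
  refine ⟨1, .one, .of_dotProduct_mulVec_pos ?_ fun x hx => ?_⟩
  · simp [Matrix.IsHermitian, lyapunov, add_comm]
  · have := h x hx
    rw [star_trivial, Matrix.neg_mulVec, dotProduct_neg,
      dotProduct_lyapunov _ _ Matrix.isSymm_one, Matrix.one_mulVec, dotProduct_comm]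
    linarith

end Lyapunov

/-! ### Hurwitz matrices have quadratic Lyapunov functions -/

section Hurwitz

variable {q : ℕ}

theorem norm_lt_one_of_re_cayley_neg {μ : ℂ} (h1 : μ ≠ 1) (h : ((μ + 1) / (μ - 1)).re < 0) :
    ‖μ‖ < 1 := by
  have hne : μ - 1 ≠ 0 := sub_ne_zero.2 h1
  have hpos : 0 < Complex.normSq (μ - 1) := Complex.normSq_pos.2 hne
  rw [Complex.div_re, ← add_div, div_lt_iff₀ hpos, zero_mul] at h
  simp only [Complex.add_re, Complex.sub_re, Complex.one_re, Complex.add_im, Complex.sub_im,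
    Complex.one_im] at h
  have : ‖μ‖ ^ 2 < 1 := by
    rw [← Complex.normSq_eq_norm_sq, Complex.normSq_apply]
    nlinarith
  nlinarith [norm_nonneg μ]

theorem spectrum_cayley_lt_one {A C : Matrix (Fin q) (Fin q) ℂ}
    (hA : ∀ z ∈ spectrum ℂ A, z.re < 0) (hC : C * (A - 1) = A + 1) {μ : ℂ}
    (hμ : μ ∈ spectrum ℂ C) : ‖μ‖ < 1 := by
  have hunit : IsUnit (A - 1) := by
    by_contra h
    have h1 : (1 : ℂ) ∈ spectrum ℂ A := by
      rw [spectrum.mem_iff, map_one, ← IsUnit.neg_iff, neg_sub]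
      exact h
    have := hA 1 h1
    norm_num at this
  rw [spectrum.mem_iff] at hμ
  have hμ' : ¬IsUnit ((algebraMap ℂ _ μ - C) * (A - 1)) := fun h =>
    hμ (by
      have h2 := h.mul hunit.unit⁻¹.isUnit
      rwa [mul_assoc, IsUnit.mul_val_inv, mul_one] at h2)
  have hform : (algebraMap ℂ _ μ - C) * (A - 1) = (μ - 1) • A - (μ + 1) • (1 : Matrix _ _ ℂ) := by
    rw [sub_mul, hC, Algebra.algebraMap_eq_smul_one, smul_mul_assoc, one_mul]
    module
  rw [hform] at hμ'
  have hμ1 : μ ≠ 1 := by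
    rintro rfl
    apply hμ'
    rw [sub_self, zero_smul, zero_sub, IsUnit.neg_iff]
    exact (isUnit_one).smul (Units.mk0 ((1 : ℂ) + 1) (by norm_num))
  have hne : μ - 1 ≠ 0 := sub_ne_zero.2 hμ1
  refine norm_lt_one_of_re_cayley_neg hμ1 (hA _ ?_)
  rw [spectrum.mem_iff]
  intro h
  apply hμ'
  have h3 := h.smul (Units.mk0 (-(μ - 1)) (neg_ne_zero.2 hne))
  convert h3 using 1
  rw [Units.smul_mk0, Algebra.algebraMap_eq_smul_one, smul_sub, smul_smul]
  have : -(μ - 1) * ((μ + 1) / (μ - 1)) = -(μ + 1) := by field_simp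
  rw [this]
  module

/-- Some power of a complex matrix with spectrum in the open unit disc is a strict contraction. -/
theorem exists_pow_norm_lt_one {C : Matrix (Fin q) (Fin q) ℂ}
    (h : ∀ μ ∈ spectrum ℂ C, ‖μ‖ < 1) : ∃ n, 1 ≤ n ∧ ‖C ^ n‖ < 1 := by
  rcases subsingleton_or_nontrivial (Matrix (Fin q) (Fin q) ℂ) with hs | hs
  · exact ⟨1, le_rfl, by rw [Subsingleton.elim (C ^ 1) 0]; simp⟩
  have hr : spectralRadius ℂ C < 1 := by
    have := spectrum.spectralRadius_lt_of_forall_lt C (r := 1) fun k hk => by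
      rw [← NNReal.coe_lt_coe]; exact h k hk
    simpa using this
  have hlim := spectrum.pow_nnnorm_pow_one_div_tendsto_nhds_spectralRadius C
  obtain ⟨n, hn, hn1⟩ := ((hlim.eventually_lt_const hr).and (eventually_ge_atTop 1)).exists
  refine ⟨n, hn1, ?_⟩
  have hpos : (0 : ℝ) < 1 / n := by positivity
  have : (‖C ^ n‖₊ : ENNReal) < 1 := by
    by_contra! hge
    exact absurd (ENNReal.one_le_rpow hge hpos) (not_le.2 hn)
  rw [← NNReal.coe_one, ← coe_nnnorm, NNReal.coe_lt_coe]
  exact_mod_cast this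

theorem dotProduct_mulVec_self_lt {C : Matrix (Fin q) (Fin q) ℝ}
    (hC : ‖C.map (algebraMap ℝ ℂ)‖ < 1) {x : Fin q → ℝ} (hx : x ≠ 0) :
    (C *ᵥ x) ⬝ᵥ (C *ᵥ x) < x ⬝ᵥ x := by
  have key : ∀ v : Fin q → ℝ, ‖WithLp.toLp 2 (fun i => (v i : ℂ))‖ = euclNorm v := fun v => by
    rw [euclNorm, EuclideanSpace.norm_eq, EuclideanSpace.norm_eq]
    simp
  have h1 := Matrix.l2_opNorm_mulVec (C.map (algebraMap ℝ ℂ)) (WithLp.toLp 2 (fun i => (x i : ℂ)))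
  have h2 : (C.map (algebraMap ℝ ℂ)) *ᵥ (fun i => (x i : ℂ)) = fun i => ((C *ᵥ x) i : ℂ) := by
    ext i
    simp [Matrix.mulVec, dotProduct]
  have h3 : euclNorm (C *ᵥ x) ≤ ‖C.map (algebraMap ℝ ℂ)‖ * euclNorm x := by
    rw [← key, ← key, ← h2]
    exact h1
  have h4 : 0 < euclNorm x := by
    simpa [euclNorm] using hx
  rw [← euclNorm_sq, ← euclNorm_sq]
  have h5 : euclNorm (C *ᵥ x) < euclNorm x := by nlinarith
  nlinarith [euclNorm_nonneg (C *ᵥ x)]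

theorem sum_pow_sub_stein {C : Matrix (Fin q) (Fin q) ℝ} (n : ℕ) :
    (∑ k ∈ Finset.range n, (C ^ k)ᵀ * C ^ k)
      - Cᵀ * (∑ k ∈ Finset.range n, (C ^ k)ᵀ * C ^ k) * C = 1 - (C ^ n)ᵀ * C ^ n := by
  induction n with
  | zero => simp
  | succ n ih =>
    rw [Finset.sum_range_succ]
    have h : (C ^ (n + 1))ᵀ * C ^ (n + 1) = Cᵀ * ((C ^ n)ᵀ * C ^ n) * C := by
      rw [pow_succ, Matrix.transpose_mul]; simp only [mul_assoc]
    rw [h, mul_add, add_mul, add_sub_add_comm, ih]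
    abel

/-- The Cayley transform `C = (A + 1)(A - 1)⁻¹` of a Hurwitz matrix has its spectrum in the open
unit disc, so `Cⁿ` is a contraction for some `n`. Then `∑_{k<n} (Cᵏ)ᵀ Cᵏ` is a Lyapunov function
for `C` in discrete time, hence one for `A` in continuous time. -/
theorem OffPolicy.IsHurwitz.hasLyapunovCertificate {A : Matrix (Fin q) (Fin q) ℝ}
    (hA : IsHurwitz A) : HasLyapunovCertificate A := by
  set φ := (algebraMap ℝ ℂ).mapMatrix (m := Fin q) with hφ
  have hφA : ∀ M, φ M = M.map (algebraMap ℝ ℂ) := fun M => rfl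
  have hdet : IsUnit (A - 1) := by
    rw [Matrix.isUnit_iff_isUnit_det]
    have h1 : IsUnit (φ A - 1) := by
      by_contra h
      have h1 : (1 : ℂ) ∈ spectrum ℂ (φ A) := by
        rw [spectrum.mem_iff, map_one, ← IsUnit.neg_iff, neg_sub]
        exact h
      have := hA 1 h1
      norm_num at this
    rw [← map_one φ, ← map_sub, Matrix.isUnit_iff_isUnit_det, hφ, ← RingHom.map_det,
      isUnit_iff_ne_zero] at h1
    exact isUnit_iff_ne_zero.2 fun h => h1 (by rw [h, map_zero])
  set N := A - 1 with hN
  set C := (A + 1) * N⁻¹ with hC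
  have hCN : C * N = A + 1 := by
    rw [hC, Matrix.mul_assoc, Matrix.nonsing_inv_mul _ ((Matrix.isUnit_iff_isUnit_det _).1 hdet),
      Matrix.mul_one]
  obtain ⟨n, hn, hlt⟩ := exists_pow_norm_lt_one (C := φ C) fun μ hμ =>
    spectrum_cayley_lt_one (A := φ A) hA
      (by rw [← map_one φ, ← map_sub, ← map_add, ← map_mul, hCN]) hμ
  rw [← map_pow, hφA] at hlt
  set Y := ∑ k ∈ Finset.range n, (C ^ k)ᵀ * C ^ k with hY
  have hYpos : Y.PosDef := by
    obtain ⟨l, rfl⟩ : ∃ l, n = l + 1 := ⟨n - 1, by omega⟩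
    rw [hY, Finset.sum_range_succ']
    refine Matrix.PosDef.posSemidef_add
      (Matrix.posSemidef_sum _ fun k _ => posSemidef_transpose_mul_self _) ?_
    simpa using Matrix.PosDef.one
  refine ⟨Y, hYpos, ?_⟩
  have hstein : Y - Cᵀ * Y * C = 1 - (C ^ n)ᵀ * C ^ n := sum_pow_sub_stein n
  have hS : (Y - Cᵀ * Y * C).PosDef := by
    rw [hstein]
    refine .of_dotProduct_mulVec_pos (by simp [Matrix.IsHermitian]) fun x hx => ?_
    have h1 := dotProduct_mulVec_self_lt hlt hx
    rw [star_trivial, Matrix.sub_mulVec, dotProduct_sub, Matrix.one_mulVec,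
      ← Matrix.mulVec_mulVec, Matrix.dotProduct_mulVec x, Matrix.vecMul_transpose]
    linarith
  have hkey : -lyapunov A Y = (1 / 2 : ℝ) • (Nᵀ * (Y - Cᵀ * Y * C) * N) := by
    have h1 : Nᵀ * (Y - Cᵀ * Y * C) * N = Nᵀ * Y * N - (C * N)ᵀ * Y * (C * N) := by
      rw [Matrix.transpose_mul C N]; noncomm_ring
    have h2 : Nᵀ * Y * N - (A + 1)ᵀ * Y * (A + 1) = (2 : ℝ) • (-lyapunov A Y) := by
      rw [hN, Matrix.transpose_sub, Matrix.transpose_add, Matrix.transpose_one, lyapunov, two_smul]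
      noncomm_ring
    rw [h1, hCN, h2, smul_smul]
    norm_num
  rw [hkey]
  refine Matrix.PosDef.smul ?_ (by norm_num)
  have := hS.conjTranspose_mul_mul_same (Matrix.mulVec_injective_iff_isUnit.2 hdet)
  simpa using this

end Hurwitz

/-! ### Policy iteration for the Riccati equation -/

section Kleinman

variable {q m : ℕ} {M : Mode q m} {Q : Matrix (Fin q) (Fin q) ℝ} {R : Matrix (Fin m) (Fin m) ℝ}

/-- One step of policy iteration: `P` is the cost of the gain `K` (a Lyapunov equation), and `K'`
is the improved gain `R⁻¹ Bᵀ P`. -/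
structure IsPolicyStep (M : Mode q m) (Q : Matrix (Fin q) (Fin q) ℝ)
    (R : Matrix (Fin m) (Fin m) ℝ) (K : Matrix (Fin m) (Fin q) ℝ)
    (P : Matrix (Fin q) (Fin q) ℝ) (K' : Matrix (Fin m) (Fin q) ℝ) : Prop where
  symm : P.IsSymm
  evaluation : lyapunov (M.closedLoop K) P = -(Q + Kᵀ * R * K)
  improvement : R * K' = M.Bᵀ * P

/-- When `R L = Bᵀ P`, the input matrix can be eliminated from the closed-loop Lyapunov operator
at `P`. -/
theorem lyapunov_closedLoop {P : Matrix (Fin q) (Fin q) ℝ} {L : Matrix (Fin m) (Fin q) ℝ}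
    (hR : R.IsSymm) (hP : P.IsSymm) (hL : R * L = M.Bᵀ * P) (K : Matrix (Fin m) (Fin q) ℝ) :
    lyapunov (M.closedLoop K) P = lyapunov M.A P - Kᵀ * R * L - Lᵀ * R * K := by
  have h : P * M.B = Lᵀ * R := by
    have := congrArg Matrix.transpose hL
    rw [Matrix.transpose_mul, Matrix.transpose_mul, hR.eq, hP.eq, Matrix.transpose_transpose]
      at this
    exact this.symm
  rw [lyapunov, lyapunov, Mode.closedLoop, Matrix.transpose_sub, Matrix.transpose_mul, sub_mul,
    mul_sub, Matrix.mul_assoc Kᵀ, Matrix.mul_assoc Kᵀ, hL, ← h, Matrix.mul_assoc P]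
  abel

theorem lyapunov_closedLoop_change {P : Matrix (Fin q) (Fin q) ℝ} {L : Matrix (Fin m) (Fin q) ℝ}
    (hR : R.IsSymm) (hP : P.IsSymm) (hL : R * L = M.Bᵀ * P) (K₁ K₂ : Matrix (Fin m) (Fin q) ℝ) :
    lyapunov (M.closedLoop K₂) P =
      lyapunov (M.closedLoop K₁) P + (K₁ - K₂)ᵀ * R * L + Lᵀ * R * (K₁ - K₂) := by
  rw [lyapunov_closedLoop hR hP hL, lyapunov_closedLoop hR hP hL, Matrix.transpose_sub,
    Matrix.sub_mul, Matrix.sub_mul, Matrix.mul_sub]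
  abel

theorem transpose_sub_mul_mul_sub (R : Matrix (Fin m) (Fin m) ℝ) (a b : Matrix (Fin m) (Fin q) ℝ) :
    (a - b)ᵀ * R * (a - b) = aᵀ * R * a - aᵀ * R * b - bᵀ * R * a + bᵀ * R * b := by
  rw [Matrix.transpose_sub, Matrix.sub_mul, Matrix.sub_mul, Matrix.mul_sub, Matrix.mul_sub]
  abel

theorem transpose_sub_mul_mul_add (R : Matrix (Fin m) (Fin m) ℝ) (a b c : Matrix (Fin m) (Fin q) ℝ) :
    (a - b)ᵀ * R * c + cᵀ * R * (a - b)
      = aᵀ * R * c - bᵀ * R * c + cᵀ * R * a - cᵀ * R * b := by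
  rw [Matrix.transpose_sub, Matrix.sub_mul, Matrix.sub_mul, Matrix.mul_sub]
  abel

namespace IsPolicyStep

variable {K K' K'' : Matrix (Fin m) (Fin q) ℝ} {P P' : Matrix (Fin q) (Fin q) ℝ}

theorem lyapunov_improved (hR : R.IsSymm) (h : IsPolicyStep M Q R K P K') :
    lyapunov (M.closedLoop K') P = -(Q + K'ᵀ * R * K' + (K - K')ᵀ * R * (K - K')) := by
  rw [lyapunov_closedLoop_change hR h.symm h.improvement K K', h.evaluation, add_assoc,
    transpose_sub_mul_mul_add, transpose_sub_mul_mul_sub]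
  abel

theorem posDef (hQ : Q.PosDef) (hR : R.PosDef) (hK : HasLyapunovCertificate (M.closedLoop K))
    (h : IsPolicyStep M Q R K P K') : P.PosDef := by
  have hW : (Q + Kᵀ * R * K).PosDef :=
    hQ.add_posSemidef (posSemidef_transpose_mul_mul hR.posSemidef K)
  have hpsd : P.PosSemidef := hK.posSemidef h.symm (by
    rw [h.evaluation, neg_neg]; exact hW.posSemidef)
  refine .of_dotProduct_mulVec_pos (by simpa using hpsd.isHermitian) fun x hx => ?_
  -- At a zero `x` of the form, `P x = 0`, which the Lyapunov equation excludes.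
  refine lt_of_le_of_ne (hpsd.dotProduct_mulVec_nonneg x) fun h0 => ?_
  have h1 := (hpsd.dotProduct_mulVec_zero_iff x).1 h0.symm
  have h2 := dotProduct_lyapunov (M.closedLoop K) P h.symm x
  rw [h1, dotProduct_zero, mul_zero, h.evaluation, Matrix.neg_mulVec, dotProduct_neg] at h2
  linarith [hW.dotProduct_pos_real hx]

/-- The improved gain is certified by the cost of the previous one. -/
theorem certificate_improved (hQ : Q.PosDef) (hR : R.PosDef)
    (hK : HasLyapunovCertificate (M.closedLoop K)) (h : IsPolicyStep M Q R K P K') :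
    HasLyapunovCertificate (M.closedLoop K') := by
  refine ⟨P, h.posDef hQ hR hK, ?_⟩
  rw [h.lyapunov_improved hR.isSymm_real, neg_neg]
  exact (hQ.add_posSemidef (posSemidef_transpose_mul_mul hR.posSemidef _)).add_posSemidef
    (posSemidef_transpose_mul_mul hR.posSemidef _)

theorem cost_antitone (hQ : Q.PosDef) (hR : R.PosDef)
    (hK : HasLyapunovCertificate (M.closedLoop K)) (h : IsPolicyStep M Q R K P K')
    (h' : IsPolicyStep M Q R K' P' K'') : (P - P').PosSemidef := by
  refine (h.certificate_improved hQ hR hK).posSemidef (h.symm.sub h'.symm) ?_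
  rw [lyapunov_sub, h.lyapunov_improved hR.isSymm_real, h'.evaluation]
  convert posSemidef_transpose_mul_mul hR.posSemidef (K - K') using 1
  abel

theorem gain_sub_eq (hR : R.PosDef) (h : R * K = M.Bᵀ * P) (h' : R * K' = M.Bᵀ * P') :
    K - K' = R⁻¹ * M.Bᵀ * (P - P') := by
  have hu : IsUnit R.det := (Matrix.isUnit_iff_isUnit_det _).1 hR.isUnit
  rw [Matrix.mul_assoc, Matrix.mul_sub, ← h, ← h', ← Matrix.mul_sub, ← Matrix.mul_assoc,
    Matrix.nonsing_inv_mul _ hu, Matrix.one_mul]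

end IsPolicyStep

variable {Pst : Matrix (Fin q) (Fin q) ℝ}

/-- The solution of the Riccati equation is a fixed point of policy iteration. -/
theorem OffPolicy.IsRiccatiSolution.isPolicyStep (hR : R.PosDef)
    (h : IsRiccatiSolution M Q R Pst) :
    IsPolicyStep M Q R (M.gain R Pst) Pst (M.gain R Pst) := by
  have hu : IsUnit R.det := (Matrix.isUnit_iff_isUnit_det _).1 hR.isUnit
  have himp : R * M.gain R Pst = M.Bᵀ * Pst := by
    rw [Mode.gain, Matrix.mul_assoc, ← Matrix.mul_assoc R, Matrix.mul_nonsing_inv _ hu,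
      Matrix.one_mul]
  refine ⟨h.posDef.isSymm_real, ?_, himp⟩
  rw [lyapunov_closedLoop hR.isSymm_real h.posDef.isSymm_real himp]
  have h1 : Pst * M.B * R⁻¹ * M.Bᵀ * Pst = (M.gain R Pst)ᵀ * R * M.gain R Pst := by
    rw [Matrix.mul_assoc _ R, himp, Mode.gain, Matrix.transpose_mul, Matrix.transpose_mul,
      Matrix.transpose_nonsing_inv, hR.isSymm_real.eq, h.posDef.isSymm_real.eq,
      Matrix.transpose_transpose]
    simp only [Matrix.mul_assoc]
  have h2 := h.riccati
  rw [h1] at h2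
  have h3 : lyapunov M.A Pst = (M.gain R Pst)ᵀ * R * M.gain R Pst - Q := by
    rw [lyapunov, eq_sub_iff_add_eq]
    exact sub_eq_zero.1 h2
  rw [h3]
  abel

theorem OffPolicy.IsRiccatiSolution.certificate (hQ : Q.PosDef) (hR : R.PosDef)
    (h : IsRiccatiSolution M Q R Pst) : HasLyapunovCertificate (M.closedLoop (M.gain R Pst)) := by
  refine ⟨Pst, h.posDef, ?_⟩
  rw [(h.isPolicyStep hR).evaluation, neg_neg]
  exact hQ.add_posSemidef (posSemidef_transpose_mul_mul hR.posSemidef _)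

namespace IsPolicyStep

variable {K K' K'' : Matrix (Fin m) (Fin q) ℝ} {P P' : Matrix (Fin q) (Fin q) ℝ}

theorem optimal_le (hR : R.PosDef) (hst : IsRiccatiSolution M Q R Pst)
    (hK : HasLyapunovCertificate (M.closedLoop K)) (h : IsPolicyStep M Q R K P K') :
    (P - Pst).PosSemidef := by
  have hs := hst.isPolicyStep hR
  refine hK.posSemidef (h.symm.sub hs.symm) ?_
  rw [lyapunov_sub, h.evaluation,
    lyapunov_closedLoop_change hR.isSymm_real hs.symm hs.improvement (M.gain R Pst) K,
    hs.evaluation, add_assoc, transpose_sub_mul_mul_add]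
  convert posSemidef_transpose_mul_mul hR.posSemidef (K - M.gain R Pst) using 1
  rw [transpose_sub_mul_mul_sub]
  abel

/-- A small step of policy iteration means that the Riccati residual is small, quadratically. The
error `X` of the cost then obeys `A*ᵀ X + X A* ≥ -e` for the optimal closed loop `A*`, and the
comparison principle, applied to the matrix `e / (2γ) - X`, bounds it by `e / (2γ)`. -/
theorem norm_sub_optimal_le (hQ : Q.PosDef) (hR : R.PosDef) (hst : IsRiccatiSolution M Q R Pst)
    {γ : ℝ} (hγ : 0 < γ)
    (hform : ∀ x, x ⬝ᵥ M.closedLoop (M.gain R Pst) *ᵥ x ≤ -γ * (x ⬝ᵥ x))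
    (hK : HasLyapunovCertificate (M.closedLoop K)) (h : IsPolicyStep M Q R K P K')
    (h' : IsPolicyStep M Q R K' P' K'') :
    ‖P' - Pst‖ ≤ ‖(K'' - K')ᵀ * R * (K'' - K')‖ / (2 * γ) := by
  have hs := hst.isPolicyStep hR
  set Ks := M.gain R Pst with hKs
  set E := (K'' - K')ᵀ * R * (K'' - K') with hE
  have hX := h'.optimal_le hR hst (h.certificate_improved hQ hR hK)
  set X := P' - Pst with hXdef
  set c := ‖E‖ / (2 * γ) with hc
  have hc0 : 0 ≤ c := by positivity
  have hcγ : 2 * γ * c = ‖E‖ := by rw [hc]; field_simp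
  have hlyap : lyapunov (M.closedLoop Ks) X = (K'' - Ks)ᵀ * R * (K'' - Ks) - E := by
    rw [hXdef, lyapunov_sub, hs.evaluation,
      lyapunov_closedLoop_change hR.isSymm_real h'.symm h'.improvement K' Ks, h'.evaluation,
      add_assoc, transpose_sub_mul_mul_add, hE, transpose_sub_mul_mul_sub, transpose_sub_mul_mul_sub]
    abel
  have hone : (c • (1 : Matrix (Fin q) (Fin q) ℝ)).IsSymm := Matrix.isSymm_one.smul c
  have hsymm : (c • (1 : Matrix (Fin q) (Fin q) ℝ) - X).IsSymm := hone.sub hX.isSymm_real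
  have hcmp : (c • (1 : Matrix (Fin q) (Fin q) ℝ) - X).PosSemidef := by
    refine (hst.certificate hQ hR).posSemidef hsymm (posSemidef_iff_real.2 ⟨?_, fun x => ?_⟩)
    · simp only [Matrix.IsSymm, lyapunov, Matrix.transpose_neg, Matrix.transpose_add,
        Matrix.transpose_mul, hsymm.eq, Matrix.transpose_transpose]
      rw [add_comm]
    · have h1 := hform x
      have h2 := dotProduct_mulVec_le (M := E) x
      have h3 := (posSemidef_iff_real.1
        (posSemidef_transpose_mul_mul hR.posSemidef (K'' - Ks))).2 x
      rw [lyapunov_sub, hlyap, Matrix.neg_mulVec, dotProduct_neg, Matrix.sub_mulVec,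
        dotProduct_sub, Matrix.sub_mulVec, dotProduct_sub, dotProduct_lyapunov _ _ hone,
        Matrix.smul_mulVec, Matrix.one_mulVec, dotProduct_smul, dotProduct_comm (_ *ᵥ x) x,
        smul_eq_mul]
      rw [← hKs]
      rw [← hcγ] at h2
      linarith [mul_le_mul_of_nonneg_left h1 hc0]
  refine norm_le_of_posSemidef hc0 hX fun x => ?_
  have := (posSemidef_iff_real.1 hcmp).2 x
  rw [Matrix.sub_mulVec, dotProduct_sub, Matrix.smul_mulVec, Matrix.one_mulVec, dotProduct_smul,
    smul_eq_mul] at this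
  linarith

/-- The quadratic estimate in terms of the value matrices; its constant depends on the mode
only. -/
theorem norm_sub_optimal_le_sq (hQ : Q.PosDef) (hR : R.PosDef)
    (hst : IsRiccatiSolution M Q R Pst) {γ : ℝ} (hγ : 0 < γ)
    (hform : ∀ x, x ⬝ᵥ M.closedLoop (M.gain R Pst) *ᵥ x ≤ -γ * (x ⬝ᵥ x))
    (hK : HasLyapunovCertificate (M.closedLoop K)) (h : IsPolicyStep M Q R K P K')
    (h' : IsPolicyStep M Q R K' P' K'') :
    ‖P' - Pst‖ ≤ ‖R‖ * ‖R⁻¹ * M.Bᵀ‖ ^ 2 / (2 * γ) * ‖P' - P‖ ^ 2 := by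
  refine (norm_sub_optimal_le hQ hR hst hγ hform hK h h').trans ?_
  have h1 : ‖K'' - K'‖ ≤ ‖R⁻¹ * M.Bᵀ‖ * ‖P' - P‖ := by
    rw [gain_sub_eq hR h'.improvement h.improvement]
    exact Matrix.l2_opNorm_mul _ _
  have h2 : ‖(K'' - K')ᵀ * R * (K'' - K')‖ ≤ ‖R‖ * (‖R⁻¹ * M.Bᵀ‖ * ‖P' - P‖) ^ 2 := by
    have ht : ‖(K'' - K')ᵀ‖ = ‖K'' - K'‖ := by
      simpa using Matrix.l2_opNorm_conjTranspose (K'' - K')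
    calc _ ≤ ‖(K'' - K')ᵀ‖ * ‖R‖ * ‖K'' - K'‖ :=
          (Matrix.l2_opNorm_mul _ _).trans (by gcongr; exact Matrix.l2_opNorm_mul _ _)
      _ = ‖R‖ * ‖K'' - K'‖ ^ 2 := by rw [ht]; ring
      _ ≤ _ := by gcongr
  calc _ ≤ ‖R‖ * (‖R⁻¹ * M.Bᵀ‖ * ‖P' - P‖) ^ 2 / (2 * γ) := by gcongr
    _ = _ := by ring

end IsPolicyStep

/-- A tolerance that guarantees a prescribed accuracy of the gain, whatever the initial gain. -/
theorem exists_tolerance (hQ : Q.PosDef) (hR : R.PosDef)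
    (hst : IsRiccatiSolution M Q R Pst) {γ : ℝ} (hγ : 0 < γ)
    (hform : ∀ x, x ⬝ᵥ M.closedLoop (M.gain R Pst) *ᵥ x ≤ -γ * (x ⬝ᵥ x)) {η : ℝ} (hη : 0 < η) :
    ∃ ε₀ > 0, ∀ (K K' K'' : Matrix (Fin m) (Fin q) ℝ) (P P' : Matrix (Fin q) (Fin q) ℝ),
      HasLyapunovCertificate (M.closedLoop K) → IsPolicyStep M Q R K P K' →
      IsPolicyStep M Q R K' P' K'' → ‖P' - P‖ < ε₀ → ‖K'' - M.gain R Pst‖ < η := by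
  set g := ‖R⁻¹ * M.Bᵀ‖ with hg
  set c := g * (‖R‖ * g ^ 2 / (2 * γ)) with hc
  have hc0 : 0 ≤ c := by positivity
  -- The error is at most `c ‖P' - P‖ ^ 2`, and the square is at most `‖P' - P‖` by the bound `1`.
  refine ⟨min 1 (η / (c + 1)), by positivity, fun K K' K'' P P' hK h h' hlt => ?_⟩
  obtain ⟨hlt1, hlt2⟩ := lt_min_iff.1 hlt
  rw [lt_div_iff₀ (by positivity)] at hlt2
  have h1 := h.norm_sub_optimal_le_sq hQ hR hst hγ hform hK h'
  have h2 : ‖K'' - M.gain R Pst‖ ≤ g * ‖P' - Pst‖ := by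
    rw [IsPolicyStep.gain_sub_eq hR h'.improvement (hst.isPolicyStep hR).improvement]
    exact Matrix.l2_opNorm_mul _ _
  have hn := norm_nonneg (P' - P)
  calc _ ≤ g * ‖P' - Pst‖ := h2
    _ ≤ g * (‖R‖ * g ^ 2 / (2 * γ) * ‖P' - P‖ ^ 2) := by gcongr
    _ = c * ‖P' - P‖ ^ 2 := by rw [hc]; ring
    _ < η := by nlinarith

section Sequence

variable {K : ℕ → Matrix (Fin m) (Fin q) ℝ} {P : ℕ → Matrix (Fin q) (Fin q) ℝ}

theorem certificate_of_steps (hQ : Q.PosDef) (hR : R.PosDef)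
    (h0 : HasLyapunovCertificate (M.closedLoop (K 0)))
    (h : ∀ k, HasLyapunovCertificate (M.closedLoop (K k)) →
      IsPolicyStep M Q R (K k) (P k) (K (k + 1))) (k : ℕ) :
    HasLyapunovCertificate (M.closedLoop (K k)) := by
  induction k with
  | zero => exact h0
  | succ k ih => exact (h k ih).certificate_improved hQ hR ih

/-- The traces of the value matrices decrease, so the steps tend to zero. -/
theorem tendsto_steps_zero (hQ : Q.PosDef) (hR : R.PosDef)
    (hcert : ∀ k, HasLyapunovCertificate (M.closedLoop (K k)))
    (h : ∀ k, IsPolicyStep M Q R (K k) (P k) (K (k + 1))) :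
    Tendsto (fun k => ‖P (k + 1) - P k‖) atTop (𝓝 0) := by
  have hD : ∀ k, (P k - P (k + 1)).PosSemidef := fun k =>
    (h k).cost_antitone hQ hR (hcert k) (h (k + 1))
  have hanti : Antitone fun k => (P k).trace := antitone_nat_of_succ_le fun k => by
    have := (hD k).trace_nonneg
    rw [Matrix.trace_sub] at this
    linarith
  have hbdd : BddBelow (Set.range fun k => (P k).trace) :=
    ⟨0, by rintro _ ⟨k, rfl⟩; exact ((h k).posDef hQ hR (hcert k)).posSemidef.trace_nonneg⟩
  have hlim := tendsto_atTop_ciInf hanti hbdd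
  have hlim2 := hlim.sub (hlim.comp (tendsto_add_atTop_nat 1))
  rw [sub_self] at hlim2
  refine squeeze_zero (fun _ => norm_nonneg _) (fun k => ?_) hlim2
  rw [norm_sub_rev]
  refine (norm_le_trace_of_posSemidef (hD k)).trans ?_
  simp [Matrix.trace_sub]

theorem tendsto_gain (hQ : Q.PosDef) (hR : R.PosDef)
    (hst : IsRiccatiSolution M Q R Pst) {γ : ℝ} (hγ : 0 < γ)
    (hform : ∀ x, x ⬝ᵥ M.closedLoop (M.gain R Pst) *ᵥ x ≤ -γ * (x ⬝ᵥ x))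
    (hcert : ∀ k, HasLyapunovCertificate (M.closedLoop (K k)))
    (h : ∀ k, IsPolicyStep M Q R (K k) (P k) (K (k + 1))) :
    Tendsto K atTop (𝓝 (M.gain R Pst)) := by
  -- A small step from `P k` to `P (k + 1)` controls the gain `K (k + 2)`.
  rw [← tendsto_add_atTop_iff_nat 2, Metric.tendsto_atTop]
  intro η hη
  obtain ⟨ε₀, hε₀, hε⟩ := exists_tolerance hQ hR hst hγ hform hη
  obtain ⟨N, hN⟩ := eventually_atTop.1
    ((tendsto_steps_zero hQ hR hcert h).eventually_lt_const hε₀)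
  refine ⟨N, fun k hk => ?_⟩
  rw [dist_eq_norm]
  exact hε _ _ _ _ _ (hcert k) (h k) (h (k + 1)) (hN k hk)

theorem exists_stopsAt (hQ : Q.PosDef) (hR : R.PosDef)
    (hcert : ∀ k, HasLyapunovCertificate (M.closedLoop (K k)))
    (h : ∀ k, IsPolicyStep M Q R (K k) (P k) (K (k + 1))) {ε : ℝ} (hε : 0 < ε) :
    ∃ k, StopsAt P ε k := by
  classical
  have hex : ∃ k, ‖P (k + 1) - P k‖ < ε :=
    ((tendsto_steps_zero hQ hR hcert h).eventually_lt_const hε).exists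
  exact ⟨Nat.find hex, Nat.find_spec hex, fun i hi => not_lt.1 (Nat.find_min hex hi)⟩

end Sequence

end Kleinman

/-! ### The learning equation -/

section LearningEquation

variable {p q m : ℕ} {M : Mode q m} {Q : Matrix (Fin q) (Fin q) ℝ} {R : Matrix (Fin m) (Fin m) ℝ}

/-- The matrix whose vectorization is row `i` of `δ_ξξ`. -/
def OffPolicy.Data.boundary (D : Data p q m) (i : Fin (p + 1)) : Matrix (Fin q) (Fin q) ℝ :=
  Matrix.of fun a b => D.dXX i (a, b)

/-- The matrix whose vectorization is row `i` of `I_ξξ`. -/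
def OffPolicy.Data.gram (D : Data p q m) (i : Fin (p + 1)) : Matrix (Fin q) (Fin q) ℝ :=
  Matrix.of fun a b => D.iXX i (a, b)

/-- The matrix whose vectorization is row `i` of `I_ξu`. -/
def OffPolicy.Data.cross (D : Data p q m) (i : Fin (p + 1)) : Matrix (Fin q) (Fin m) ℝ :=
  Matrix.of fun a b => D.iXU i (a, b)

/-- The identity that data satisfy when the increments obey `ξ' = A ξ + B u` on every window. -/
structure OffPolicy.Data.IsGeneratedBy (D : Data p q m) (M : Mode q m) : Prop where
  gram_symm : ∀ i, (D.gram i).IsSymm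
  boundary_eq : ∀ i, D.boundary i =
    M.A * D.gram i + D.gram i * M.Aᵀ + M.B * (D.cross i)ᵀ + D.cross i * M.Bᵀ

theorem mulVec_vec_eq_trace {n l : ℕ} (E : Matrix (Fin (p + 1)) (Fin n × Fin l) ℝ)
    (N : Matrix (Fin l) (Fin n) ℝ) (i : Fin (p + 1)) :
    (E *ᵥ Matrix.vec N) i = ((Matrix.of fun a b => E i (a, b)) * N).trace := by
  simp [Matrix.mulVec, dotProduct, Matrix.trace, Matrix.mul_apply, Fintype.sum_prod_type]

/-- The residual of the learning equation expresses, against the data, the defects of the two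
equations that define a step of policy iteration. -/
theorem OffPolicy.Data.IsGeneratedBy.residual_eq {D : Data p q m} (hD : D.IsGeneratedBy M)
    (hR : R.IsSymm) (K K' : Matrix (Fin m) (Fin q) ℝ) {P : Matrix (Fin q) (Fin q) ℝ}
    (hP : P.IsSymm) (i : Fin (p + 1)) :
    D.residual Q R K P K' i =
      (D.gram i * (lyapunov M.A P - Kᵀ * R * K' - K'ᵀ * R * K + (Q + Kᵀ * R * K))).trace
        + 2 * (D.cross i * (M.Bᵀ * P - R * K')).trace := by
  have hG := (hD.gram_symm i).eq
  have e1 : (D.dXX *ᵥ Matrix.vec P) i = (D.gram i * lyapunov M.A P).trace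
      + 2 * (D.cross i * (M.Bᵀ * P)).trace := by
    rw [mulVec_vec_eq_trace]
    change (D.boundary i * P).trace = _
    have t1 : (M.A * D.gram i * P).trace = (D.gram i * (P * M.A)).trace := by
      rw [Matrix.mul_assoc, Matrix.trace_mul_comm, Matrix.mul_assoc]
    have t2 : (M.B * (D.cross i)ᵀ * P).trace = (D.cross i * (M.Bᵀ * P)).trace := by
      rw [← Matrix.trace_transpose, Matrix.transpose_mul, Matrix.transpose_mul,
        Matrix.transpose_transpose, hP.eq, Matrix.trace_mul_comm, Matrix.mul_assoc]
    rw [hD.boundary_eq, add_mul, add_mul, add_mul, Matrix.trace_add, Matrix.trace_add,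
      Matrix.trace_add, t1, t2, lyapunov, mul_add, Matrix.trace_add, Matrix.mul_assoc (D.gram i),
      Matrix.mul_assoc (D.cross i)]
    ring
  have e2 : (D.gram i * (Kᵀ * R * K')).trace = (D.gram i * (K'ᵀ * R * K)).trace := by
    rw [← Matrix.trace_transpose, Matrix.transpose_mul, hG, Matrix.trace_mul_comm,
      Matrix.transpose_mul, Matrix.transpose_mul, Matrix.transpose_transpose, hR.eq,
      Matrix.mul_assoc K'ᵀ]
  have e3 : (D.iXX *ᵥ Matrix.vec (Kᵀ * R * K')) i = (D.gram i * (Kᵀ * R * K')).trace :=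
    mulVec_vec_eq_trace _ _ _
  have e4 : (D.iXU *ᵥ Matrix.vec (R * K')) i = (D.cross i * (R * K')).trace :=
    mulVec_vec_eq_trace _ _ _
  have e5 : (D.iXX *ᵥ Matrix.vec (Q + Kᵀ * R * K)) i = (D.gram i * (Q + Kᵀ * R * K)).trace :=
    mulVec_vec_eq_trace _ _ _
  rw [Data.residual, Data.theta, Data.xi, Matrix.fromCols_mulVec_sumElim, Matrix.sub_mulVec,
    Matrix.smul_mulVec, Matrix.smul_mulVec, ← Matrix.mulVec_mulVec, ← Matrix.mulVec_mulVec,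
    Matrix.kronecker_mulVec_vec, Matrix.kronecker_mulVec_vec, Matrix.transpose_one,
    Matrix.mul_one, Matrix.mul_one]
  simp only [Pi.sub_apply, Pi.add_apply, Pi.smul_apply, Pi.neg_apply, smul_eq_mul]
  rw [e1, e3, e4, e5, mul_add (D.gram i) (_ - _ - _), mul_sub, mul_sub,
    Matrix.mul_sub, Matrix.trace_add, Matrix.trace_sub, Matrix.trace_sub, Matrix.trace_sub, ← e2]
  ring

/-- Under the rank condition the data distinguish symmetric matrices and gains: the number
`q (q + 1) / 2 + m q` is the dimension of the space of such pairs, and the data see only the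
symmetric part of the first component. -/
theorem OffPolicy.Data.RankCondition.eq_zero {D : Data p q m} (hD : D.RankCondition)
    (hG : ∀ i, (D.gram i).IsSymm) {Y : Matrix (Fin q) (Fin q) ℝ} {Z : Matrix (Fin m) (Fin q) ℝ}
    (hY : Y.IsSymm) (h : ∀ i, (D.gram i * Y).trace + 2 * (D.cross i * Z).trace = 0) :
    Y = 0 ∧ Z = 0 := by
  let Φ : ((Sym2 (Fin q) → ℝ) × (Fin q × Fin m → ℝ)) →ₗ[ℝ] (Fin (p + 1) → ℝ) :=
    { toFun := fun s => D.iXX *ᵥ (fun ab => s.1 s(ab.1, ab.2)) + D.iXU *ᵥ s.2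
      map_add' := fun s t => by
        rw [Prod.snd_add, Matrix.mulVec_add, add_add_add_comm, ← Matrix.mulVec_add D.iXX]
        rfl
      map_smul' := fun c s => by
        rw [Prod.smul_snd, Matrix.mulVec_smul, RingHom.id_apply, smul_add,
          ← Matrix.mulVec_smul D.iXX]
        rfl }
  have hΦ : ∀ s, Φ s = D.iXX *ᵥ (fun ab => s.1 s(ab.1, ab.2)) + D.iXU *ᵥ s.2 := fun _ => rfl
  have hrange : (Matrix.fromCols D.iXX D.iXU).mulVecLin.range ≤ Φ.range := by
    rintro _ ⟨v, rfl⟩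
    refine ⟨(Sym2.lift ⟨fun a b => (v (.inl (a, b)) + v (.inl (b, a))) / 2, fun a b => by
      simp only [add_comm]⟩, fun ab => v (.inr ab)), ?_⟩
    rw [hΦ, Matrix.mulVecLin_apply, Matrix.fromCols_mulVec]
    congr 1
    funext i
    -- The rows of `iXX` are symmetric, so they do not see the antisymmetric part of `v`.
    have hswap : ∑ a, ∑ b, D.iXX i (a, b) * v (.inl (b, a))
        = ∑ a, ∑ b, D.iXX i (a, b) * v (.inl (a, b)) := by
      rw [Finset.sum_comm]
      refine Finset.sum_congr rfl fun b _ => Finset.sum_congr rfl fun a _ => ?_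
      have := congrFun (congrFun (hG i).eq a) b
      simp only [Matrix.transpose_apply, Data.gram, Matrix.of_apply] at this
      rw [← this]
    simp only [Matrix.mulVec, dotProduct, Fintype.sum_prod_type, Sym2.lift_mk, Function.comp]
    simp only [mul_div_assoc', mul_add, add_div, Finset.sum_add_distrib, ← Finset.sum_div]
    rw [hswap]
    ring
  have hinj : Function.Injective Φ := by
    have h1 := Submodule.finrank_mono hrange
    have h2 := Φ.finrank_range_add_finrank_ker
    have h3 : Module.finrank ℝ ((Sym2 (Fin q) → ℝ) × (Fin q × Fin m → ℝ))
        = q * (q + 1) / 2 + m * q := by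
      rw [Module.finrank_prod, Module.finrank_fintype_fun_eq_card,
        Module.finrank_fintype_fun_eq_card, Sym2.card, Fintype.card_prod, Fintype.card_fin,
        Fintype.card_fin, Nat.choose_two_right, Nat.add_sub_cancel, mul_comm (q + 1), mul_comm m]
    have h4 : Module.finrank ℝ (Matrix.fromCols D.iXX D.iXU).mulVecLin.range
        = q * (q + 1) / 2 + m * q := hD
    rw [← LinearMap.ker_eq_bot, ← Submodule.finrank_eq_zero (R := ℝ)]
    omega
  have hz : ((Sym2.lift ⟨fun a b => Y b a, fun a b => hY.apply a b⟩,
      (2 : ℝ) • Matrix.vec Z) : (Sym2 (Fin q) → ℝ) × (Fin q × Fin m → ℝ)) = 0 := by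
    apply hinj
    rw [map_zero, hΦ]
    funext i
    have e1 : (fun ab : Fin q × Fin q => Sym2.lift ⟨fun a b => Y b a, fun a b => hY.apply a b⟩
        s(ab.1, ab.2)) = Matrix.vec Y := rfl
    rw [Pi.add_apply, e1, Matrix.mulVec_smul, Pi.smul_apply, mulVec_vec_eq_trace,
      mulVec_vec_eq_trace, smul_eq_mul]
    exact h i
  constructor
  · ext a b
    exact congrFun (congrArg Prod.fst hz) s(b, a)
  · have := congrArg Prod.snd hz
    rw [← Matrix.vec_eq_zero_iff]
    simpa using this

/-- With data from a single mode that satisfy the rank condition, the solutions of the learning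
equation are the steps of policy iteration. -/
theorem OffPolicy.Data.IsSolution.isPolicyStep {D : Data p q m} (hQ : Q.PosDef) (hR : R.PosDef)
    (hD : D.IsGeneratedBy M) (hrank : D.RankCondition) {K K' : Matrix (Fin m) (Fin q) ℝ}
    {P : Matrix (Fin q) (Fin q) ℝ} (hK : HasLyapunovCertificate (M.closedLoop K))
    (h : D.IsSolution Q R K P K') : IsPolicyStep M Q R K P K' := by
  have hRs := hR.isSymm_real
  have hu : IsUnit R.det := (Matrix.isUnit_iff_isUnit_det _).1 hR.isUnit
  have hsq : (Kᵀ * R * K).IsSymm := (posSemidef_transpose_mul_mul hR.posSemidef K).isSymm_real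
  have hW : (-(Q + Kᵀ * R * K)).IsSymm := (hQ.isSymm_real.add hsq).neg
  -- The policy iteration step solves the equation exactly, so every least-squares solution does.
  obtain ⟨P₁, hP₁, hlyap⟩ := hK.exists_solution hW
  obtain ⟨K₁, hK₁⟩ : ∃ K₁, R * K₁ = M.Bᵀ * P₁ :=
    ⟨R⁻¹ * (M.Bᵀ * P₁), by rw [← Matrix.mul_assoc, Matrix.mul_nonsing_inv _ hu, Matrix.one_mul]⟩
  have hres₁ : D.residual Q R K P₁ K₁ = 0 := by
    funext i
    rw [lyapunov_closedLoop hRs hP₁ hK₁] at hlyap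
    rw [hD.residual_eq hRs K K₁ hP₁, hlyap, hK₁, neg_add_cancel, sub_self]
    simp
  have hres : D.residual Q R K P K' = 0 := by
    have := h.2 P₁ K₁ hP₁
    rw [hres₁] at this
    have h0 : euclNorm (0 : Fin (p + 1) → ℝ) = 0 := by simp [euclNorm]
    rw [h0] at this
    simpa [euclNorm] using this
  have hYs : (lyapunov M.A P - Kᵀ * R * K' - K'ᵀ * R * K + (Q + Kᵀ * R * K)).IsSymm := by
    have e1 : (Kᵀ * R * K')ᵀ = K'ᵀ * R * K := by
      simp [Matrix.transpose_mul, hRs.eq, Matrix.mul_assoc]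
    have e2 : (lyapunov M.A P)ᵀ = lyapunov M.A P := by
      simp [lyapunov, Matrix.transpose_mul, h.1.eq, add_comm]
    have e3 : (K'ᵀ * R * K)ᵀ = Kᵀ * R * K' := by rw [← e1, Matrix.transpose_transpose]
    rw [Matrix.IsSymm, Matrix.transpose_add, Matrix.transpose_sub, Matrix.transpose_sub, e1, e2,
      e3, (hQ.isSymm_real.add hsq).eq]
    abel
  obtain ⟨hY, hZ⟩ := hrank.eq_zero hD.gram_symm hYs fun i => by
    rw [← hD.residual_eq hRs K K' h.1, hres, Pi.zero_apply]
  rw [sub_eq_zero] at hZ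
  refine ⟨h.1, ?_, hZ.symm⟩
  rw [lyapunov_closedLoop hRs h.1 hZ.symm]
  exact eq_neg_of_add_eq_zero_left hY

end LearningEquation

/-! ### Data along trajectories -/

section Trajectory

variable {q m : ℕ}

theorem intervalIntegrable_sum {ι : Type*} [Fintype ι] {f : ι → ℝ → ℝ} {s s' : ℝ}
    (h : ∀ c, IntervalIntegrable (f c) MeasureTheory.volume s s') :
    IntervalIntegrable (fun t => ∑ c, f c t) MeasureTheory.volume s s' := by
  simpa only [Finset.sum_fn] using IntervalIntegrable.sum Finset.univ fun c _ => h c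

/-- The product rule for `x xᵀ` along `x' = A x + B v`, integrated over a window. Right derivatives
suffice, as `v` need not be continuous. -/
theorem integral_product_rule (A : Matrix (Fin q) (Fin q) ℝ) (B : Matrix (Fin q) (Fin m) ℝ)
    {x : ℝ → Fin q → ℝ} {v : ℝ → Fin m → ℝ} {s s' : ℝ} (hs : s ≤ s')
    (hx : ContinuousOn x (Set.Icc s s'))
    (hx' : ∀ t ∈ Set.Ioo s s', HasDerivWithinAt x (A *ᵥ x t + B *ᵥ v t) (Set.Ioi t) t)
    (hv : ∀ c, IntervalIntegrable (fun t => v t c) MeasureTheory.volume s s') (a b : Fin q) :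
    x s' a * x s' b - x s a * x s b =
      (∑ c, A a c * ∫ t in s..s', x t c * x t b) + (∑ c, (∫ t in s..s', x t a * x t c) * A b c)
        + (∑ c, B a c * ∫ t in s..s', x t b * v t c)
        + ∑ c, (∫ t in s..s', x t a * v t c) * B b c := by
  have hxc : ∀ c, ContinuousOn (fun t => x t c) (Set.Icc s s') := fun c =>
    (continuous_apply c).comp_continuousOn hx
  have hxx : ∀ c d, IntervalIntegrable (fun t => x t c * x t d) MeasureTheory.volume s s' :=
    fun c d => ((hxc c).mul (hxc d)).intervalIntegrable_of_Icc hs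
  have hxv : ∀ c d, IntervalIntegrable (fun t => x t c * v t d) MeasureTheory.volume s s' :=
    fun c d => (hv d).continuousOn_mul (by rw [Set.uIcc_of_le hs]; exact hxc c)
  have s1 : IntervalIntegrable (fun t => ∑ c, A a c * (x t c * x t b)) MeasureTheory.volume s s' :=
    intervalIntegrable_sum fun c => (hxx _ _).const_mul _
  have s2 : IntervalIntegrable (fun t => ∑ c, (x t a * x t c) * A b c)
      MeasureTheory.volume s s' := intervalIntegrable_sum fun c => (hxx _ _).mul_const _
  have s3 : IntervalIntegrable (fun t => ∑ c, B a c * (x t b * v t c))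
      MeasureTheory.volume s s' := intervalIntegrable_sum fun c => (hxv _ _).const_mul _
  have s4 : IntervalIntegrable (fun t => ∑ c, (x t a * v t c) * B b c)
      MeasureTheory.volume s s' := intervalIntegrable_sum fun c => (hxv _ _).mul_const _
  have hder := intervalIntegral.integral_eq_sub_of_hasDeriv_right_of_le hs
    (f := fun t => x t a * x t b)
    (f' := fun t => (∑ c, A a c * (x t c * x t b)) + (∑ c, (x t a * x t c) * A b c)
        + (∑ c, B a c * (x t b * v t c)) + ∑ c, (x t a * v t c) * B b c)
    ((hxc a).mul (hxc b)) (fun t ht => ?_) ?_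
  · rw [← hder, intervalIntegral.integral_add, intervalIntegral.integral_add,
      intervalIntegral.integral_add, intervalIntegral.integral_finsetSum,
      intervalIntegral.integral_finsetSum, intervalIntegral.integral_finsetSum,
      intervalIntegral.integral_finsetSum]
    · simp only [intervalIntegral.integral_const_mul, intervalIntegral.integral_mul_const]
    exacts [fun c _ => (hxv _ _).mul_const _, fun c _ => (hxv _ _).const_mul _,
      fun c _ => (hxx _ _).mul_const _, fun c _ => (hxx _ _).const_mul _,
      s1, s2, s1.add s2, s3, (s1.add s2).add s3, s4]
  · have h := hasDerivWithinAt_pi.1 (hx' t ht)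
    refine HasDerivWithinAt.congr_deriv (HasDerivWithinAt.fun_mul (h a) (h b)) ?_
    simp only [Pi.add_apply, Matrix.mulVec, dotProduct, add_mul, mul_add, Finset.sum_mul,
      Finset.mul_sum]
    have e1 : ∀ c, A a c * (x t c * x t b) = A a c * x t c * x t b := fun c => by ring
    have e2 : ∀ c, x t a * x t c * A b c = x t a * (A b c * x t c) := fun c => by ring
    have e3 : ∀ c, B a c * (x t b * v t c) = B a c * v t c * x t b := fun c => by ring
    have e4 : ∀ c, x t a * v t c * B b c = x t a * (B b c * v t c) := fun c => by ring
    simp only [e1, e2, e3, e4]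
    ring
  · exact ((s1.add s2).add s3).add s4

theorem OffPolicy.Schedule.data_isGeneratedBy (S : Schedule) {τ δ : ℝ} (hδ : 0 ≤ δ) (M : Mode q m)
    {ξ : ℝ → Fin q → ℝ} {u : ℝ → Fin m → ℝ} {n : ℕ}
    (hx : ∀ i, ContinuousOn (incr τ ξ) (Set.Icc (S.start n i) (S.start n i + δ)))
    (hx' : ∀ i, ∀ t ∈ Set.Ioo (S.start n i) (S.start n i + δ),
      HasDerivWithinAt (incr τ ξ) (M.A *ᵥ incr τ ξ t + M.B *ᵥ incr τ u t) (Set.Ioi t) t)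
    (hv : ∀ i c, IntervalIntegrable (fun t => incr τ u t c) MeasureTheory.volume
      (S.start n i) (S.start n i + δ)) :
    (S.data τ δ ξ u n).IsGeneratedBy M := by
  refine ⟨fun i => ?_, fun i => ?_⟩
  · ext a b
    simp only [Data.gram, Schedule.data, Matrix.transpose_apply, Matrix.of_apply]
    simp only [mul_comm]
  · ext a b
    simp only [Data.boundary, Data.gram, Data.cross, Schedule.data, Matrix.of_apply,
      Matrix.add_apply, Matrix.mul_apply, Matrix.transpose_apply]
    exact integral_product_rule M.A M.B (by linarith) (hx i) (hx' i) (hv i) a b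

end Trajectory

/-! ### Timetable of the learning phases -/

section Timetable

variable {J : ℕ} {S : Schedule} {τ δ ΔT ζ w : ℝ} {T : Fin (J + 1) → ℝ}

namespace OffPolicy.Schedule.IsPeriodic

theorem window_subset (hS : S.IsPeriodic τ δ ΔT ζ) (n : ℕ) (i : Fin (S.p n + 1)) :
    S.begins n ≤ S.start n i ∧ S.start n i + δ ≤ S.finishes δ n := by
  have h1 := hS.mono n (Fin.zero_le i)
  have h2 := hS.mono n (Fin.le_last i)
  exact ⟨h1, by simp only [Schedule.finishes]; linarith⟩

theorem begins_add_le (hS : S.IsPeriodic τ δ ΔT ζ) (n : ℕ) :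
    S.begins n + δ ≤ S.finishes δ n :=
  (hS.window_subset n 0).2

theorem le_begins (hS : S.IsPeriodic τ δ ΔT ζ) (hΔT : 0 < ΔT) (n : ℕ) :
    τ + n * δ ≤ S.begins n := by
  induction n with
  | zero => simp [hS.first]
  | succ n ih =>
    have h1 := hS.begins_add_le n
    rw [hS.next]
    push_cast
    linarith

theorem delay_le_begins (hS : S.IsPeriodic τ δ ΔT ζ) (hδ : 0 < δ) (hΔT : 0 < ΔT) (n : ℕ) :
    τ ≤ S.begins n := by
  have := hS.le_begins hΔT n
  have : 0 ≤ n * δ := by positivity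
  linarith

theorem exists_lt_begins (hS : S.IsPeriodic τ δ ΔT ζ) (hδ : 0 < δ) (hΔT : 0 < ΔT) (t : ℝ) :
    ∃ n, t < S.begins n := by
  obtain ⟨n, hn⟩ := exists_nat_gt ((t - τ) / δ)
  rw [div_lt_iff₀ hδ] at hn
  exact ⟨n, by linarith [hS.le_begins hΔT n]⟩

end OffPolicy.Schedule.IsPeriodic

/-- Switching times that start at `0` and are at least `w` apart. -/
structure HasDwellTime (T : Fin (J + 1) → ℝ) (w : ℝ) : Prop where
  zero : T 0 = 0
  gap : ∀ j : Fin J, w ≤ T j.succ - T j.castSucc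

namespace HasDwellTime

theorem strictMono (hT : HasDwellTime T w) (hw : 0 < w) : StrictMono T :=
  Fin.strictMono_iff_lt_succ.2 fun j => by linarith [hT.gap j]

theorem nonneg (hT : HasDwellTime T w) (hw : 0 < w) (j : Fin (J + 1)) : 0 ≤ T j := by
  rw [← hT.zero]
  exact (hT.strictMono hw).monotone (Fin.zero_le j)

theorem add_le (hT : HasDwellTime T w) (hw : 0 < w) {i j : Fin (J + 1)} (h : j < i) :
    T j + w ≤ T i := by
  obtain ⟨j', rfl⟩ := Fin.exists_castSucc_eq.2 (ne_of_lt (lt_of_lt_of_le h (Fin.le_last i)))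
  have h1 := (hT.strictMono hw).monotone (show j'.succ ≤ i from Fin.castSucc_lt_iff_succ_le.1 h)
  linarith [hT.gap j']

end HasDwellTime

theorem activeMode_eq {t : ℝ} {j : Fin (J + 1)} (h1 : T j ≤ t) (h2 : ∀ i, j < i → t < T i) :
    activeMode T t = j := by
  refine le_antisymm (Finset.sup_le fun i hi => ?_) ?_
  · rw [Finset.mem_filter] at hi
    by_contra h
    exact absurd hi.2 (not_le.2 (h2 i (not_le.1 h)))
  · exact Finset.le_sup (f := id) (Finset.mem_filter.2 ⟨Finset.mem_univ _, h1⟩)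

theorem le_activeMode {t : ℝ} {i : Fin (J + 1)} (h : T i ≤ t) : i ≤ activeMode T t :=
  Finset.le_sup (f := id) (Finset.mem_filter.2 ⟨Finset.mem_univ _, h⟩)

theorem lt_of_activeMode_lt {t : ℝ} {i : Fin (J + 1)} (h : activeMode T t < i) : t < T i := by
  by_contra h'
  exact absurd (le_activeMode (not_lt.1 h')) (not_le.2 h)

theorem apply_activeMode_le {t : ℝ} (h : T 0 ≤ t) : T (activeMode T t) ≤ t := by
  have hne : (Finset.univ.filter fun j => T j ≤ t).Nonempty :=
    ⟨0, Finset.mem_filter.2 ⟨Finset.mem_univ _, h⟩⟩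
  obtain ⟨j, hj, hj'⟩ := Finset.exists_mem_eq_sup _ hne id
  rw [activeMode, hj']
  exact (Finset.mem_filter.1 hj).2

theorem OffPolicy.Schedule.IsPeriodic.isClean_or_isMixed (hS : S.IsPeriodic τ δ ΔT ζ)
    (hδ : 0 < δ) (hΔT : 0 < ΔT) (hT : HasDwellTime T w) (n : ℕ) :
    (∃ j, S.IsClean τ δ T n j) ∨ ∃ j, S.IsMixed τ δ T n j := by
  have h0 : T 0 ≤ S.begins n - τ := by
    rw [hT.zero]; linarith [hS.delay_le_begins hδ hΔT n]
  by_cases h : ∀ i, activeMode T (S.begins n - τ) < i → S.finishes δ n ≤ T i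
  · exact .inl ⟨_, apply_activeMode_le h0, h⟩
  · push Not at h
    obtain ⟨i, hi, hlt⟩ := h
    have hi0 : i ≠ 0 := ne_of_gt (lt_of_le_of_lt (Fin.zero_le _) hi)
    obtain ⟨i', rfl⟩ := Fin.exists_succ_eq.2 hi0
    exact .inr ⟨i', lt_of_activeMode_lt hi, hlt⟩

/-- The first phase that begins at least `τ` after a switch ends before the next switch. -/
theorem OffPolicy.Schedule.IsPeriodic.exists_isClean (hS : S.IsPeriodic τ δ ΔT ζ)
    (hδ : 0 < δ) (hΔT : 0 < ΔT) (hw : 0 < w) (hT : HasDwellTime T w)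
    (hdelay : τ + ΔT + 2 * ζ ≤ w) (j : Fin (J + 1)) : ∃ n, S.IsClean τ δ T n j := by
  classical
  have hex : ∃ n, T j + τ ≤ S.begins n := (hS.exists_lt_begins hδ hΔT _).imp fun _ h => h.le
  have hspec := Nat.find_spec hex
  refine ⟨Nat.find hex, by linarith, fun i hi => ?_⟩
  have hgap := hT.add_le hw hi
  have hdur := hS.duration_le (Nat.find hex)
  have hTj := hT.nonneg hw j
  have hζ : 0 < ζ := by linarith [hS.begins_add_le 0, hS.duration_le 0]
  -- The phase begins by time `T j + τ + ζ + ΔT`, because its predecessor begins before `T j + τ`.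
  rcases hn : Nat.find hex with _ | k
  · rw [hn] at hdur
    rw [hS.first] at hdur
    linarith
  · have hmin := Nat.find_min hex (m := k) (by omega)
    rw [hn, hS.next] at hdur
    have := hS.duration_le k
    linarith

/-- The predecessor of a clean phase: it is clean for the same mode, or it straddles the preceding
switch, or it is clean for the preceding mode. -/
theorem OffPolicy.Schedule.IsPeriodic.pred_of_isClean (hS : S.IsPeriodic τ δ ΔT ζ)
    (hτ : 0 < τ) (hδ : 0 < δ) (hΔT : 0 < ΔT) (hw : 0 < w) (hT : HasDwellTime T w)
    (hdelay : τ + ΔT + 2 * ζ ≤ w) {n : ℕ} {j : Fin (J + 1)}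
    (h : S.IsClean τ δ T (n + 1) j) :
    S.IsClean τ δ T n j ∨
      ∃ i : Fin J, j = i.succ ∧ (S.IsMixed τ δ T n i ∨ S.IsClean τ δ T n i.castSucc) := by
  have hnext := hS.next n
  have hlen := hS.begins_add_le (n + 1)
  have hle : S.finishes δ n ≤ S.finishes δ (n + 1) := by linarith
  by_cases hb : T j ≤ S.begins n - τ
  · exact .inl ⟨hb, fun i hi => hle.trans (h.2 i hi)⟩
  right
  rw [not_le] at hb
  have hj0 : j ≠ 0 := by
    rintro rfl
    rw [hT.zero] at hb
    linarith [hS.delay_le_begins hδ hΔT n]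
  obtain ⟨i, rfl⟩ := Fin.exists_succ_eq.2 hj0
  refine ⟨i, rfl, ?_⟩
  by_cases hf : T i.succ < S.finishes δ n
  · exact .inl ⟨hb, hf⟩
  · rw [not_lt] at hf
    refine .inr ⟨?_, fun l hl => hf.trans ((hT.strictMono hw).monotone
      (Fin.castSucc_lt_iff_succ_le.1 hl))⟩
    have h1 := hT.gap i
    have h2 := h.1
    have h3 := hS.duration_le n
    have h4 := hS.begins_add_le n
    linarith

/-- A sufficiently long time after a switch, the most recent phase is clean. -/
theorem OffPolicy.Schedule.IsPeriodic.isClean_of_late (hS : S.IsPeriodic τ δ ΔT ζ)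
    {t : ℝ} {n : ℕ} {j : Fin (J + 1)}
    (hlate : T j + (τ + ΔT + 2 * ζ) ≤ t) (hj : ∀ i, j < i → t < T i)
    (hn1 : t < S.finishes δ (n + 1)) (hn : S.finishes δ n ≤ t) : S.IsClean τ δ T n j := by
  have h1 := hS.next n
  have h2 := hS.duration_le n
  have h3 := hS.duration_le (n + 1)
  exact ⟨by linarith, fun i hi => hn.trans (hj i hi).le⟩

end Timetable

/-! ### Closed-loop runs -/

section Run

variable {q m J : ℕ} {modes : Fin (J + 1) → Mode q m} {Q : Matrix (Fin q) (Fin q) ℝ}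
  {R : Matrix (Fin m) (Fin m) ℝ} {K₀ : Matrix (Fin m) (Fin q) ℝ} {T : Fin (J + 1) → ℝ}
  {S : Schedule} {τ δ ΔT ζ ε ebar w : ℝ} {e : ℝ → Fin m → ℝ} {ξ : ℝ → Fin q → ℝ}
  {u : ℝ → Fin m → ℝ} {P : ℕ → ℕ → Matrix (Fin q) (Fin q) ℝ}
  {K : ℕ → ℕ → Matrix (Fin m) (Fin q) ℝ}

/-- At every time the control is the feedback with the initial gain of some phase `n`, up to an
error that is bounded like the exploration noise. -/
theorem OffPolicy.IsRun.exists_feedback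
    (h : IsRun modes Q R K₀ T S τ δ ε e ξ u P K) (hS : S.IsPeriodic τ δ ΔT ζ)
    (hδ : 0 < δ) (hΔT : 0 < ΔT) (he : ∀ t, euclNorm (e t) ≤ ebar) {t : ℝ} (ht : 0 ≤ t) :
    ∃ n, t < S.finishes δ n ∧ (∀ k, n = k + 1 → S.finishes δ k ≤ t) ∧
      ∃ v, euclNorm v ≤ ebar ∧ u t = -(K n 0 *ᵥ ξ t) + v := by
  classical
  have hex : ∃ n, t < S.finishes δ n :=
    (hS.exists_lt_begins hδ hΔT t).imp fun n hn => by linarith [hS.begins_add_le n]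
  have hspec := Nat.find_spec hex
  refine ⟨Nat.find hex, hspec, fun k hk => not_lt.1 (Nat.find_min hex (by omega)), ?_⟩
  rcases le_or_gt (S.begins (Nat.find hex)) t with hb | hb
  · exact ⟨e t, he t, h.control_learning _ t hb hspec⟩
  rcases hn : Nat.find hex with _ | k
  · rw [hn] at hb
    exact ⟨e t, he t, by rw [h.initial_gain]; exact h.control_warmup t ht hb⟩
  · rw [hn] at hb
    refine ⟨0, ?_, ?_⟩
    · have := (euclNorm_nonneg (e t)).trans (he t)
      simpa [euclNorm] using this
    · rw [add_zero]
      exact h.control_post k t (not_lt.1 (Nat.find_min hex (by omega))) hb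

theorem intervalIntegrable_feedback {a b : ℝ} (hab : a ≤ b)
    (hξ : ContinuousOn ξ (Set.Icc a b)) (he : Measurable e) (hbd : ∀ t, euclNorm (e t) ≤ ebar)
    {G : Matrix (Fin m) (Fin q) ℝ} (hu : ∀ t, a ≤ t → t < b → u t = -(G *ᵥ ξ t) + e t)
    (c : Fin m) : IntervalIntegrable (fun t => u t c) MeasureTheory.volume a b := by
  have h1 : IntervalIntegrable (fun t => (-(G *ᵥ ξ t)) c) MeasureTheory.volume a b := by
    refine ContinuousOn.intervalIntegrable_of_Icc hab ?_
    exact ((continuous_apply c).comp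
      ((continuous_const.matrix_mulVec continuous_id).neg)).comp_continuousOn hξ
  have h2 : IntervalIntegrable (fun t => e t c) MeasureTheory.volume a b := by
    rw [intervalIntegrable_iff_integrableOn_Ico_of_le hab]
    refine MeasureTheory.Measure.integrableOn_of_bounded (M := ebar) measure_Ico_lt_top.ne
      ((measurable_pi_apply c).comp he).aestronglyMeasurable (.of_forall fun t => ?_)
    exact (PiLp.norm_apply_le (WithLp.toLp 2 (e t)) c).trans (hbd t)
  have h3 := h1.add h2
  rw [intervalIntegrable_iff_integrableOn_Ico_of_le hab] at h3 ⊢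
  refine h3.congr_fun (fun t ht => ?_) measurableSet_Ico
  simp only [hu t ht.1 ht.2, Pi.add_apply]

/-- The control is integrable on bounded intervals, since these meet only finitely many phases. -/
theorem OffPolicy.IsRun.intervalIntegrable
    (h : IsRun modes Q R K₀ T S τ δ ε e ξ u P K) (hS : S.IsPeriodic τ δ ΔT ζ)
    (hτ : 0 ≤ τ) (hδ : 0 < δ) (hΔT : 0 < ΔT) (he : Measurable e)
    (hbd : ∀ t, euclNorm (e t) ≤ ebar) {a b : ℝ} (ha : 0 ≤ a) (hab : a ≤ b) (c : Fin m) :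
    IntervalIntegrable (fun t => u t c) MeasureTheory.volume a b := by
  have hcont : ∀ {s s' : ℝ}, 0 ≤ s → ContinuousOn ξ (Set.Icc s s') := fun hs =>
    h.continuousOn.mono fun t ht => hs.trans ht.1
  have hbeg : ∀ n, 0 ≤ S.begins n := fun n => hτ.trans (hS.delay_le_begins hδ hΔT n)
  have hle : ∀ n, S.begins n ≤ S.finishes δ n := fun n => by linarith [hS.begins_add_le n]
  have hlearn : ∀ n, IntervalIntegrable (fun t => u t c) MeasureTheory.volume
      (S.begins n) (S.finishes δ n) := fun n =>
    intervalIntegrable_feedback (hle n) (hcont (hbeg n)) he hbd (h.control_learning n) c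
  have hall : ∀ n, IntervalIntegrable (fun t => u t c) MeasureTheory.volume 0
      (S.finishes δ n) := by
    intro n
    induction n with
    | zero =>
      exact (intervalIntegrable_feedback (hbeg 0) (hcont le_rfl) he hbd h.control_warmup c).trans
        (hlearn 0)
    | succ n ih =>
      refine (ih.trans ?_).trans (hlearn (n + 1))
      refine intervalIntegrable_feedback (e := 0) (ebar := 0) (G := K (n + 1) 0)
        (by rw [hS.next]; linarith) (hcont ((hbeg n).trans (hle n))) measurable_const
        (fun t => by simp [euclNorm]) (fun t h1 h2 => ?_) c
      simpa using h.control_post n t h1 h2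
  obtain ⟨n, hn⟩ := hS.exists_lt_begins hδ hΔT b
  refine (hall n).mono_set ?_
  rw [Set.uIcc_of_le hab, Set.uIcc_of_le (by linarith [hle n, hbeg n])]
  exact Set.Icc_subset_Icc ha (by linarith [hle n])

/-- On clean data the offset `d` cancels in the increments, which therefore obey the linear
dynamics of a single mode. -/
theorem OffPolicy.IsRun.data_isGeneratedBy
    (h : IsRun modes Q R K₀ T S τ δ ε e ξ u P K) (hS : S.IsPeriodic τ δ ΔT ζ)
    (hτ : 0 < τ) (hδ : 0 < δ) (hΔT : 0 < ΔT) (hw : 0 < w) (hT : HasDwellTime T w)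
    (he : Measurable e) (hbd : ∀ t, euclNorm (e t) ≤ ebar) {n : ℕ} {j : Fin (J + 1)}
    (hc : S.IsClean τ δ T n j) : (S.data τ δ ξ u n).IsGeneratedBy (modes j) := by
  have hTj := hT.nonneg hw j
  have hwin := hS.window_subset n
  refine S.data_isGeneratedBy hδ.le (modes j) (fun i => ?_) (fun i t ht => ?_) fun i c => ?_
  · refine ContinuousOn.sub (h.continuousOn.mono fun t ht => ?_)
      (h.continuousOn.comp (by fun_prop) fun t ht => ?_)
    · have := (hwin i).1
      have := hc.1
      have := ht.1
      simp only [Set.mem_Ici]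
      linarith
    · have := (hwin i).1
      have := hc.1
      have := ht.1
      simp only [Set.mem_Ici]
      linarith
  · have b1 := (hwin i).1
    have b2 := (hwin i).2
    have b3 := hc.1
    obtain ⟨b4, b5⟩ := ht
    have m1 : activeMode T t = j :=
      activeMode_eq (by linarith) fun l hl => by linarith [hc.2 l hl]
    have m2 : activeMode T (t - τ) = j :=
      activeMode_eq (by linarith) fun l hl => by linarith [hc.2 l hl]
    have d1 := h.dynamics t (by linarith)
    have d2 := h.dynamics (t - τ) (by linarith)
    rw [m1] at d1
    rw [m2] at d2
    have d3 : HasDerivWithinAt (fun s => ξ (s - τ)) _ (Set.Ici t) t :=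
      d2.scomp (h := fun s => s - τ) t ((hasDerivAt_id t).sub_const τ).hasDerivWithinAt
        (fun s hs => by simp only [Set.mem_Ici] at hs ⊢; linarith)
    refine HasDerivWithinAt.congr_deriv ((d1.sub d3).mono Set.Ioi_subset_Ici_self) ?_
    rw [one_smul, incr, incr, Matrix.mulVec_sub, Matrix.mulVec_sub]
    abel
  · have b1 := (hwin i).1
    have b3 := hc.1
    have i1 := h.intervalIntegrable hS hτ.le hδ hΔT he hbd
      (a := S.start n i) (b := S.start n i + δ) (by linarith) (by linarith) c
    have i2 := (h.intervalIntegrable hS hτ.le hδ hΔT he hbd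
      (a := S.start n i - τ) (b := S.start n i + δ - τ) (by linarith) (by linarith)
      c).comp_sub_right τ
    rw [sub_add_cancel, sub_add_cancel] at i2
    exact i1.sub i2

end Run

/-! ### Gains learned along a run -/

section LearnedGains

variable {q m J : ℕ} {modes : Fin (J + 1) → Mode q m} {Q : Matrix (Fin q) (Fin q) ℝ}
  {R : Matrix (Fin m) (Fin m) ℝ} {K₀ : Matrix (Fin m) (Fin q) ℝ} {T : Fin (J + 1) → ℝ}
  {S : Schedule} {τ δ ΔT ζ ε ebar w : ℝ} {e : ℝ → Fin m → ℝ} {ξ : ℝ → Fin q → ℝ}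
  {u : ℝ → Fin m → ℝ} {P : ℕ → ℕ → Matrix (Fin q) (Fin q) ℝ}
  {K : ℕ → ℕ → Matrix (Fin m) (Fin q) ℝ}

theorem OffPolicy.IsRun.isPolicyStep_of_isClean
    (h : IsRun modes Q R K₀ T S τ δ ε e ξ u P K) (hQ : Q.PosDef) (hR : R.PosDef)
    (hS : S.IsPeriodic τ δ ΔT ζ)
    (hτ : 0 < τ) (hδ : 0 < δ) (hΔT : 0 < ΔT) (hw : 0 < w) (hT : HasDwellTime T w)
    (he : Measurable e) (hbd : ∀ t, euclNorm (e t) ≤ ebar) {n : ℕ} {j : Fin (J + 1)}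
    (hrank : (S.data τ δ ξ u n).RankCondition) (hc : S.IsClean τ δ T n j)
    (h0 : HasLyapunovCertificate ((modes j).closedLoop (K n 0))) :
    (∀ k, HasLyapunovCertificate ((modes j).closedLoop (K n k))) ∧
      ∀ k, IsPolicyStep (modes j) Q R (K n k) (P n k) (K n (k + 1)) := by
  have hgen := h.data_isGeneratedBy hS hτ hδ hΔT hw hT he hbd hc
  have hstep : ∀ k, HasLyapunovCertificate ((modes j).closedLoop (K n k)) →
      IsPolicyStep (modes j) Q R (K n k) (P n k) (K n (k + 1)) := fun k hk =>
    (h.iterate n k).isPolicyStep hQ hR hgen hrank hk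
  have hcert := certificate_of_steps hQ hR h0 hstep
  exact ⟨hcert, fun k => hstep k (hcert k)⟩

/-- A gain close to the optimal gain of one mode stabilizes the next mode, by subadditivity of the
logarithmic norm. -/
theorem hasLyapunovCertificate_of_margin {M M' : Mode q m} {K Kst : Matrix (Fin m) (Fin q) ℝ}
    {γ ρ b : ℝ} (hb : 0 < b)
    (hform : ∀ x, x ⬝ᵥ M.closedLoop Kst *ᵥ x ≤ -γ * (x ⬝ᵥ x))
    (hpert : ‖(M'.A - M.A) - (M'.B - M.B) * Kst‖ ≤ ρ) (hB : ‖M'.B‖ ≤ b)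
    (hK : ‖K - Kst‖ < (γ - ρ) / b) : HasLyapunovCertificate (M'.closedLoop K) := by
  refine hasLyapunovCertificate_of_form_neg fun x hx => ?_
  have hs : 0 < x ⬝ᵥ x := by
    rw [← euclNorm_sq]
    have : 0 < euclNorm x := by simpa [euclNorm] using hx
    positivity
  have hdec : M'.closedLoop K = M.closedLoop Kst + ((M'.A - M.A) - (M'.B - M.B) * Kst)
      + -(M'.B * (K - Kst)) := by
    simp only [Mode.closedLoop, Matrix.sub_mul, Matrix.mul_sub]
    abel
  have h2 := dotProduct_mulVec_le (M := (M'.A - M.A) - (M'.B - M.B) * Kst) x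
  have h3 := dotProduct_mulVec_le (M := -(M'.B * (K - Kst))) x
  have h4 : ‖-(M'.B * (K - Kst))‖ < γ - ρ := by
    rw [norm_neg]
    rw [lt_div_iff₀ hb] at hK
    have h5 := Matrix.l2_opNorm_mul M'.B (K - Kst)
    have h6 : ‖M'.B‖ * ‖K - Kst‖ ≤ b * ‖K - Kst‖ := by gcongr
    linarith
  rw [hdec, Matrix.add_mulVec, Matrix.add_mulVec, dotProduct_add, dotProduct_add]
  nlinarith [hform x]

variable {Kst : Fin (J + 1) → Matrix (Fin m) (Fin q) ℝ} {η : Fin (J + 1) → ℝ}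

/-- The guarantee that the stopping rule with tolerance `ε` gives for a mode: the gain that is
handed over is within `η` of the optimal one. -/
def IsTolerance (M : Mode q m) (Q : Matrix (Fin q) (Fin q) ℝ) (R : Matrix (Fin m) (Fin m) ℝ)
    (Kst : Matrix (Fin m) (Fin q) ℝ) (ε η : ℝ) : Prop :=
  ∀ (K K' K'' : Matrix (Fin m) (Fin q) ℝ) (P P' : Matrix (Fin q) (Fin q) ℝ),
    HasLyapunovCertificate (M.closedLoop K) → IsPolicyStep M Q R K P K' →
    IsPolicyStep M Q R K' P' K'' → ‖P' - P‖ < ε → ‖K'' - Kst‖ < η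

theorem IsTolerance.mono {M : Mode q m} {Kst : Matrix (Fin m) (Fin q) ℝ} {ε ε' η : ℝ}
    (h : IsTolerance M Q R Kst ε' η) (hε : ε ≤ ε') : IsTolerance M Q R Kst ε η :=
  fun K K' K'' P P' h1 h2 h3 h4 => h K K' K'' P P' h1 h2 h3 (h4.trans_le hε)

theorem OffPolicy.IsRun.handover_near
    (h : IsRun modes Q R K₀ T S τ δ ε e ξ u P K) (hQ : Q.PosDef) (hR : R.PosDef) (hε : 0 < ε)
    {n : ℕ} {j : Fin (J + 1)} (htol : IsTolerance (modes j) Q R (Kst j) ε (η j))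
    (hcert : ∀ k, HasLyapunovCertificate ((modes j).closedLoop (K n k)))
    (hstep : ∀ k, IsPolicyStep (modes j) Q R (K n k) (P n k) (K n (k + 1))) :
    ‖K (n + 1) 0 - Kst j‖ < η j := by
  obtain ⟨k, hk⟩ := exists_stopsAt hQ hR hcert hstep hε
  rw [h.handover n k hk]
  exact htol _ _ _ _ _ (hcert k) (hstep k) (hstep (k + 1)) hk.1

/-- A clean phase starts from a gain that stabilizes its mode. -/
theorem OffPolicy.IsRun.certificate_of_isClean
    (h : IsRun modes Q R K₀ T S τ δ ε e ξ u P K) (hQ : Q.PosDef) (hR : R.PosDef)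
    (hS : S.IsPeriodic τ δ ΔT ζ)
    (hτ : 0 < τ) (hδ : 0 < δ) (hΔT : 0 < ΔT) (hw : 0 < w) (hT : HasDwellTime T w)
    (hdelay : τ + ΔT + 2 * ζ ≤ w)
    (he : Measurable e) (hbd : ∀ t, euclNorm (e t) ≤ ebar)
    (hrank : ∀ n, (S.data τ δ ξ u n).RankCondition) (hε : 0 < ε)
    (hK₀ : HasLyapunovCertificate ((modes 0).closedLoop K₀))
    (htol : ∀ j, IsTolerance (modes j) Q R (Kst j) ε (η j))
    {r : Fin J → ℝ} (hηr : ∀ j : Fin J, η j.castSucc ≤ r j)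
    (hnear : ∀ (j : Fin J) (G : Matrix (Fin m) (Fin q) ℝ), ‖G - Kst j.castSucc‖ < r j →
      HasLyapunovCertificate ((modes j.succ).closedLoop G))
    (hmixed : ∀ (n : ℕ) (j : Fin J), S.IsMixed τ δ T n j → ‖K (n + 1) 0 - Kst j.castSucc‖ < r j)
    (n : ℕ) (j : Fin (J + 1)) (hc : S.IsClean τ δ T n j) :
    HasLyapunovCertificate ((modes j).closedLoop (K n 0)) := by
  induction n generalizing j with
  | zero =>
    -- The data of phase `0` begin at time `0`.
    have hj : j = 0 := by
      by_contra hj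
      have := hT.add_le hw (Fin.pos_iff_ne_zero.2 hj)
      have h1 := hc.1
      rw [hS.first, sub_self] at h1
      rw [hT.zero] at this
      linarith
    rw [hj, h.initial_gain]
    exact hK₀
  | succ n ih =>
    rcases hS.pred_of_isClean hτ hδ hΔT hw hT hdelay hc with hsame | ⟨i, rfl, hmix | hprev⟩
    · obtain ⟨hcert, hstep⟩ := h.isPolicyStep_of_isClean hQ hR hS hτ hδ hΔT hw hT he hbd
        (hrank n) hsame (ih j hsame)
      obtain ⟨k, hk⟩ := exists_stopsAt hQ hR hcert hstep hε
      rw [h.handover n k hk]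
      exact hcert _
    · exact hnear i _ (hmixed n i hmix)
    · obtain ⟨hcert, hstep⟩ := h.isPolicyStep_of_isClean hQ hR hS hτ hδ hΔT hw hT he hbd
        (hrank n) hprev (ih _ hprev)
      exact hnear i _ ((h.handover_near hQ hR hε (htol _) hcert hstep).trans_le (hηr i))

end LearnedGains

/-! ### Exponential estimates -/

section Estimates

variable {q m : ℕ}

/-- Grönwall's inequality for the squared norm; `κ` may be negative. -/
theorem euclNorm_sq_le_of_dissipation {x F : ℝ → Fin q → ℝ} {a b κ c : ℝ} (hκ : κ ≠ 0)
    (hx : ContinuousOn x (Set.Icc a b))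
    (hx' : ∀ t ∈ Set.Ico a b, HasDerivWithinAt x (F t) (Set.Ici t) t)
    (hF : ∀ t ∈ Set.Ico a b, 2 * (x t ⬝ᵥ F t) ≤ κ * euclNorm (x t) ^ 2 + c) :
    ∀ t ∈ Set.Icc a b, euclNorm (x t) ^ 2 ≤
      euclNorm (x a) ^ 2 * Real.exp (κ * (t - a)) + c / κ * (Real.exp (κ * (t - a)) - 1) := by
  have hW : ∀ t ∈ Set.Ico a b,
      HasDerivWithinAt (fun t => euclNorm (x t) ^ 2) (2 * (x t ⬝ᵥ F t)) (Set.Ici t) t := by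
    intro t ht
    have h := hasDerivWithinAt_pi.1 (hx' t ht)
    simp only [euclNorm_sq, dotProduct]
    refine HasDerivWithinAt.congr_deriv
      (HasDerivWithinAt.fun_sum fun i _ => HasDerivWithinAt.fun_mul (h i) (h i)) ?_
    rw [Finset.mul_sum]
    exact Finset.sum_congr rfl fun i _ => by ring
  have hc : ContinuousOn (fun t => euclNorm (x t) ^ 2) (Set.Icc a b) := by
    simp only [euclNorm_sq]
    exact (continuous_id.dotProduct continuous_id).comp_continuousOn hx
  intro t ht
  have := le_gronwallBound_of_liminf_deriv_right_le hc
    (fun t ht r hr => (hW t ht).liminf_right_slope_le hr) le_rfl hF t ht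
  rwa [gronwallBound_of_K_ne_0 hκ] at this

theorem euclNorm_le_of_decay {x F : ℝ → Fin q → ℝ} {a b α N : ℝ} (hα : 0 < α) (hN : 0 ≤ N)
    (hx : ContinuousOn x (Set.Icc a b))
    (hx' : ∀ t ∈ Set.Ico a b, HasDerivWithinAt x (F t) (Set.Ici t) t)
    (hF : ∀ t ∈ Set.Ico a b, x t ⬝ᵥ F t ≤ -α * euclNorm (x t) ^ 2 + N * euclNorm (x t)) :
    ∀ t ∈ Set.Icc a b,
      euclNorm (x t) ≤ Real.exp (-(α / 2) * (t - a)) * euclNorm (x a) + N / α := by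
  intro t ht
  have h := euclNorm_sq_le_of_dissipation (κ := -α) (c := N ^ 2 / α) (by linarith) hx hx'
    (fun t ht => ?_) t ht
  · have e1 : Real.exp (-α * (t - a)) = Real.exp (-(α / 2) * (t - a)) ^ 2 := by
      rw [← Real.exp_nat_mul]; congr 1; push_cast; ring
    have e2 : N ^ 2 / α / -α = -(N / α) ^ 2 := by field_simp
    rw [e1, e2] at h
    have hE := Real.exp_pos (-(α / 2) * (t - a))
    have hs := euclNorm_nonneg (x a)
    have hNα : 0 ≤ N / α := by positivity
    refine le_of_sq_le_sq (h.trans ?_) (by positivity)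
    have := mul_nonneg (mul_nonneg hE.le hs) hNα
    nlinarith [sq_nonneg (N / α * Real.exp (-(α / 2) * (t - a)))]
  · -- Young's inequality spends half of the decay rate on the linear term.
    have h1 := hF t ht
    have e3 : 2 * (N * euclNorm (x t)) ≤ α * euclNorm (x t) ^ 2 + N ^ 2 / α := by
      have : α * euclNorm (x t) ^ 2 + N ^ 2 / α - 2 * (N * euclNorm (x t))
          = (α * euclNorm (x t) - N) ^ 2 / α := by field_simp; ring
      have h0 : 0 ≤ (α * euclNorm (x t) - N) ^ 2 / α := by positivity
      linarith
    linarith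

theorem euclNorm_le_of_growth {x F : ℝ → Fin q → ℝ} {a b G N : ℝ} (hG : 0 ≤ G) (hN : 0 ≤ N)
    (hx : ContinuousOn x (Set.Icc a b))
    (hx' : ∀ t ∈ Set.Ico a b, HasDerivWithinAt x (F t) (Set.Ici t) t)
    (hF : ∀ t ∈ Set.Ico a b, x t ⬝ᵥ F t ≤ G * euclNorm (x t) ^ 2 + N * euclNorm (x t)) :
    ∀ t ∈ Set.Icc a b,
      euclNorm (x t) ≤ Real.exp ((G + 1 / 2) * (t - a)) * (euclNorm (x a) + N) := by
  intro t ht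
  have h := euclNorm_sq_le_of_dissipation (κ := 2 * G + 1) (c := N ^ 2) (by positivity) hx hx'
    (fun t ht => ?_) t ht
  · have e1 : Real.exp ((2 * G + 1) * (t - a)) = Real.exp ((G + 1 / 2) * (t - a)) ^ 2 := by
      rw [← Real.exp_nat_mul]; congr 1; push_cast; ring
    rw [e1] at h
    set E := Real.exp ((G + 1 / 2) * (t - a)) with hE
    have hE1 : 1 ≤ E := Real.one_le_exp (mul_nonneg (by positivity) (by linarith [ht.1]))
    have hs := euclNorm_nonneg (x a)
    have e2 : N ^ 2 / (2 * G + 1) ≤ N ^ 2 := div_le_self (sq_nonneg N) (by linarith)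
    have e3 : N ^ 2 / (2 * G + 1) * (E ^ 2 - 1) ≤ N ^ 2 * E ^ 2 := by
      calc _ ≤ N ^ 2 * (E ^ 2 - 1) := mul_le_mul_of_nonneg_right e2 (by nlinarith)
        _ ≤ _ := by nlinarith [sq_nonneg N]
    refine le_of_sq_le_sq (h.trans ?_) (by positivity)
    nlinarith [mul_nonneg (mul_nonneg hs hN) (sq_nonneg E)]
  · nlinarith [hF t ht, sq_nonneg (euclNorm (x t) - N)]

/-- Growth at a bounded rate during a transient of length `L`, followed by decay. -/
theorem euclNorm_le_of_transient {x F : ℝ → Fin q → ℝ} {a b α G N L : ℝ} (hα : 0 < α)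
    (hG : 0 ≤ G) (hN : 0 ≤ N) (hL : 0 ≤ L)
    (hx : ContinuousOn x (Set.Icc a b))
    (hx' : ∀ t ∈ Set.Ico a b, HasDerivWithinAt x (F t) (Set.Ici t) t)
    (hF : ∀ t ∈ Set.Ico a b, x t ⬝ᵥ F t ≤ G * euclNorm (x t) ^ 2 + N * euclNorm (x t))
    (hF' : ∀ t ∈ Set.Ico a b, a + L ≤ t →
      x t ⬝ᵥ F t ≤ -α * euclNorm (x t) ^ 2 + N * euclNorm (x t))
    (hab : a ≤ b) :
    euclNorm (x b) ≤
      Real.exp ((G + 1 / 2) * L) * Real.exp (α / 2 * L) * Real.exp (-(α / 2) * (b - a))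
        * euclNorm (x a) + (Real.exp ((G + 1 / 2) * L) * N + N / α) := by
  have hs := euclNorm_nonneg (x a)
  have hNα : 0 ≤ N / α := by positivity
  rcases le_total b (a + L) with hb | hb
  · have h1 := euclNorm_le_of_growth hG hN hx hx' hF b ⟨hab, le_rfl⟩
    have h2 : Real.exp ((G + 1 / 2) * (b - a)) ≤ Real.exp ((G + 1 / 2) * L) := by
      apply Real.exp_le_exp.2
      exact mul_le_mul_of_nonneg_left (by linarith) (by positivity)
    have h3 : 1 ≤ Real.exp (α / 2 * L) * Real.exp (-(α / 2) * (b - a)) := by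
      rw [← Real.exp_add]
      exact Real.one_le_exp (by nlinarith)
    calc _ ≤ Real.exp ((G + 1 / 2) * L) * (euclNorm (x a) + N) :=
          h1.trans (by gcongr)
      _ ≤ Real.exp ((G + 1 / 2) * L)
            * (Real.exp (α / 2 * L) * Real.exp (-(α / 2) * (b - a)) * euclNorm (x a) + N) := by
          gcongr
          exact le_mul_of_one_le_left hs h3
      _ ≤ _ := by linarith
  · have h1 := euclNorm_le_of_growth (b := a + L) hG hN
      (hx.mono (Set.Icc_subset_Icc le_rfl hb))
      (fun t ht => hx' t ⟨ht.1, ht.2.trans_le hb⟩) (fun t ht => hF t ⟨ht.1, ht.2.trans_le hb⟩)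
      (a + L) ⟨by linarith, le_rfl⟩
    have h2 := euclNorm_le_of_decay (a := a + L) (b := b) hα hN
      (hx.mono (Set.Icc_subset_Icc (by linarith) le_rfl))
      (fun t ht => hx' t ⟨by linarith [ht.1], ht.2⟩)
      (fun t ht => hF' t ⟨by linarith [ht.1], ht.2⟩ ht.1) b ⟨hb, le_rfl⟩
    rw [add_sub_cancel_left] at h1
    have e1 : Real.exp (-(α / 2) * (b - (a + L)))
        = Real.exp (α / 2 * L) * Real.exp (-(α / 2) * (b - a)) := by
      rw [← Real.exp_add]; congr 1; ring
    have e2 : Real.exp (-(α / 2) * (b - (a + L))) ≤ 1 :=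
      Real.exp_le_one_iff.2 (by nlinarith)
    calc _ ≤ Real.exp (-(α / 2) * (b - (a + L)))
            * (Real.exp ((G + 1 / 2) * L) * (euclNorm (x a) + N)) + N / α :=
          h2.trans (by gcongr)
      _ = Real.exp (-(α / 2) * (b - (a + L))) * (Real.exp ((G + 1 / 2) * L) * euclNorm (x a))
            + Real.exp (-(α / 2) * (b - (a + L))) * (Real.exp ((G + 1 / 2) * L) * N)
            + N / α := by ring
      _ ≤ Real.exp (-(α / 2) * (b - (a + L))) * (Real.exp ((G + 1 / 2) * L) * euclNorm (x a))
            + 1 * (Real.exp ((G + 1 / 2) * L) * N) + N / α := by gcongr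
      _ = _ := by rw [e1]; ring

/-- Concatenation of the estimates on the dwell intervals of the modes. -/
theorem le_of_mode_estimates {J : ℕ} {T : Fin (J + 1) → ℝ} {w M N Δ β : ℝ} (hw : 0 < w)
    (hT : HasDwellTime T w) (hM : 1 ≤ M) (hN : 0 ≤ N) (hΔ : 0 ≤ Δ) (hβ : 0 ≤ β)
    {v : Fin (J + 1) → ℝ → ℝ}
    (hjump : ∀ (j : Fin J) t, v j.succ t ≤ v j.castSucc t + Δ)
    (hmode : ∀ j t, T j ≤ t → (∀ i, j < i → t ≤ T i) →
      v j t ≤ M * Real.exp (-β * (t - T j)) * v j (T j) + N)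
    (j : Fin (J + 1)) : ∀ t, T j ≤ t → (∀ i, j < i → t ≤ T i) →
      v j t ≤ M ^ ((j : ℕ) + 1) * Real.exp (-β * t) * v 0 0
        + ((j : ℕ) + 1) * M ^ (j : ℕ) * (N + Δ) := by
  induction j using Fin.induction with
  | zero =>
    intro t h1 h2
    have := hmode 0 t h1 h2
    rw [hT.zero, sub_zero] at this
    simp only [Fin.val_zero, zero_add, pow_one, pow_zero, Nat.cast_zero, one_mul]
    linarith
  | succ j ih =>
    intro t h1 h2
    have hmono := hT.strictMono hw
    have h3 := hmode j.succ t h1 h2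
    have h4 := ih (T j.succ) (hmono.monotone (Fin.castSucc_lt_succ).le)
      fun i hi => hmono.monotone (Fin.castSucc_lt_iff_succ_le.1 hi)
    have h5 := hjump j (T j.succ)
    rw [Fin.val_castSucc] at h4
    rw [Fin.val_succ]
    set k : ℕ := (j : ℕ) with hk
    set E := Real.exp (-β * (t - T j.succ)) with hE
    have hE0 : 0 < E := Real.exp_pos _
    have hE1 : E ≤ 1 := Real.exp_le_one_iff.2 (by nlinarith)
    have hEE : E * Real.exp (-β * T j.succ) = Real.exp (-β * t) := by
      rw [hE, ← Real.exp_add]; congr 1; ring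
    have hM0 : 0 < M := by linarith
    have hMk : 1 ≤ M ^ k := one_le_pow₀ hM
    set D := ((k : ℝ) + 1) * M ^ k * (N + Δ) + Δ with hD
    have hD0 : 0 ≤ D := by positivity
    have hD1 : M * D + N ≤ ((k : ℝ) + 1 + 1) * M ^ (k + 1) * (N + Δ) := by
      have e1 : M * D = ((k : ℝ) + 1) * M ^ (k + 1) * (N + Δ) + M * Δ := by
        rw [hD, pow_succ]; ring
      have e2 : M * Δ ≤ M ^ (k + 1) * Δ := by
        gcongr
        rw [pow_succ]; nlinarith
      have e3 : N ≤ M ^ (k + 1) * N := le_mul_of_one_le_left hN (one_le_pow₀ hM)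
      rw [e1]
      linarith
    calc v j.succ t ≤ M * E * v j.succ (T j.succ) + N := h3
      _ ≤ M * E * (M ^ (k + 1) * Real.exp (-β * T j.succ) * v 0 0 + D) + N := by
          gcongr; linarith
      _ = M ^ (k + 1 + 1) * (E * Real.exp (-β * T j.succ)) * v 0 0 + M * (E * D) + N := by ring
      _ ≤ M ^ (k + 1 + 1) * (E * Real.exp (-β * T j.succ)) * v 0 0 + M * (1 * D) + N := by
          gcongr
      _ ≤ _ := by
          rw [hEE]
          push_cast
          linarith

/-- The closed-loop vector field, tested against the deviation `x - r` from the steady state `r` of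
the optimal gain, for a gain within `κ` of the optimal one. -/
theorem dotProduct_closedLoop_le {M : Mode q m} {K Kst : Matrix (Fin m) (Fin q) ℝ}
    {x r : Fin q → ℝ} {v : Fin m → ℝ} {γ κ e : ℝ} (hr : M.closedLoop Kst *ᵥ r = -M.d)
    (hform : ∀ y, y ⬝ᵥ M.closedLoop Kst *ᵥ y ≤ -γ * (y ⬝ᵥ y)) (hK : ‖K - Kst‖ ≤ κ)
    (hv : euclNorm v ≤ e) :
    (x - r) ⬝ᵥ (M.A *ᵥ x + M.B *ᵥ (-(K *ᵥ x) + v) + M.d) ≤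
      (‖M.B‖ * κ - γ) * euclNorm (x - r) ^ 2
        + ‖M.B‖ * (κ * euclNorm r + e) * euclNorm (x - r) := by
  set y := x - r with hy
  have hx : x = y + r := by rw [hy, sub_add_cancel]
  have hfield : M.A *ᵥ x + M.B *ᵥ (-(K *ᵥ x) + v) + M.d =
      M.closedLoop Kst *ᵥ y + M.B *ᵥ (-((K - Kst) *ᵥ (y + r)) + v) := by
    have h1 : M.A *ᵥ r - M.B *ᵥ (Kst *ᵥ r) = -M.d := by
      rw [← hr, Mode.closedLoop, Matrix.sub_mulVec, Matrix.mulVec_mulVec]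
    have h2 : M.d = -(M.A *ᵥ r - M.B *ᵥ (Kst *ᵥ r)) := by rw [h1, neg_neg]
    rw [h2, hx, Mode.closedLoop]
    simp only [Matrix.sub_mulVec, Matrix.mulVec_add, Matrix.mulVec_neg, Matrix.mulVec_sub,
      ← Matrix.mulVec_mulVec]
    abel
  have hs := euclNorm_nonneg y
  have hB := norm_nonneg M.B
  have b1 : euclNorm (-((K - Kst) *ᵥ (y + r)) + v) ≤ κ * (euclNorm y + euclNorm r) + e := by
    refine (euclNorm_add_le _ _).trans (add_le_add ?_ hv)
    rw [euclNorm_neg]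
    refine (euclNorm_mulVec_le _ _).trans ?_
    exact mul_le_mul hK (euclNorm_add_le _ _) (euclNorm_nonneg _) ((norm_nonneg _).trans hK)
  have b2 : y ⬝ᵥ M.B *ᵥ (-((K - Kst) *ᵥ (y + r)) + v)
      ≤ euclNorm y * (‖M.B‖ * (κ * (euclNorm y + euclNorm r) + e)) := by
    refine (dotProduct_le_euclNorm _ _).trans ?_
    gcongr
    exact (euclNorm_mulVec_le _ _).trans (by gcongr)
  have b3 := hform y
  rw [hfield, dotProduct_add]
  rw [← euclNorm_sq] at b3
  nlinarith

end Estimates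

/-! ### Convergence of the gains and practical stability -/

theorem theorem1 {q m J : ℕ}
    -- modes, weights, optimal gains, steady states
    (modes : Fin (J + 1) → Mode q m)
    (Q : Matrix (Fin q) (Fin q) ℝ) (R : Matrix (Fin m) (Fin m) ℝ) (hQ : Q.PosDef) (hR : R.PosDef)
    (Pstar : Fin (J + 1) → Matrix (Fin q) (Fin q) ℝ)
    (hPstar : ∀ j, IsRiccatiSolution (modes j) Q R (Pstar j))
    (Kstar : Fin (J + 1) → Matrix (Fin m) (Fin q) ℝ)
    (hKstar : ∀ j, Kstar j = (modes j).gain R (Pstar j))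
    (ξr : Fin (J + 1) → Fin q → ℝ)
    (hξr : ∀ j, (modes j).closedLoop (Kstar j) *ᵥ ξr j = -(modes j).d)
    -- bounded reference jumps
    (Δr : ℝ) (hΔr : 0 ≤ Δr)
    (hjump : ∀ j : Fin J, euclNorm (ξr j.castSucc - ξr j.succ) ≤ Δr)
    -- logarithmic-norm margins
    (ρ : Fin J → ℝ) (hρ : ∀ j, 0 ≤ ρ j)
    (hpert : ∀ j : Fin J,
      ‖((modes j.succ).A - (modes j.castSucc).A)
        - ((modes j.succ).B - (modes j.castSucc).B) * Kstar j.castSucc‖ ≤ ρ j)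
    (γ : Fin (J + 1) → ℝ) (hγ : ∀ j, 0 < γ j)
    (hmargin : ∀ j, logNorm ((modes j).closedLoop (Kstar j)) ≤ -γ j)
    (Bbar : ℝ) (hBbar : 0 < Bbar) (hB : ∀ j : Fin J, ‖(modes j.succ).B‖ ≤ Bbar)
    (hργ : ∀ j : Fin J, ρ j < γ j.castSucc)
    -- dwell times, delay, window length, inter-learning interval, maximal learning duration
    (ω : Fin (J + 1) → ℝ) (hω : ∀ j, 0 < ω j)
    (τ δ ΔT ζmax ν : ℝ) (hτ : 0 < τ) (hδ : 0 < δ) (hΔT : 0 < ΔT) (hν : 1 ≤ ν)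
    (hdwell : ΔT < Finset.univ.inf' Finset.univ_nonempty ω
      - Real.log (2 * ν) / Finset.univ.inf' Finset.univ_nonempty γ - 2 * ζmax)
    (hdelay : τ + ΔT + 2 * ζmax ≤ Finset.univ.inf' Finset.univ_nonempty ω)
    -- initial gain, bound on the exploration noise
    (K₀ : Matrix (Fin m) (Fin q) ℝ) (hK₀ : IsHurwitz ((modes 0).closedLoop K₀))
    (ebar : ℝ) :
    ∃ ε₀ > 0, ∃ c₁ > 0, ∃ c₂ ≥ 0, ∃ α > 0,
      ∀ (ε : ℝ), 0 < ε → ε ≤ ε₀ →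
      -- switching times
      ∀ (T : Fin (J + 1) → ℝ), T 0 = 0 →
        (∀ j : Fin J, ω j.castSucc ≤ T j.succ - T j.castSucc) →
      -- timetable of the learning phases, exploration noise
      ∀ (S : Schedule), S.IsPeriodic τ δ ΔT ζmax →
      ∀ (e : ℝ → Fin m → ℝ), Measurable e → (∀ t, euclNorm (e t) ≤ ebar) →
      -- closed-loop run of the algorithm
      ∀ (ξ : ℝ → Fin q → ℝ) (u : ℝ → Fin m → ℝ)
        (P : ℕ → ℕ → Matrix (Fin q) (Fin q) ℝ) (K : ℕ → ℕ → Matrix (Fin m) (Fin q) ℝ),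
        IsRun modes Q R K₀ T S τ δ ε e ξ u P K →
        (∀ n, (S.data τ δ ξ u n).RankCondition) →
        -- gains learned from mixed-mode data respect the margin
        (∀ (n : ℕ) (j : Fin J), S.IsMixed τ δ T n j →
          ‖K (n + 1) 0 - Kstar j.castSucc‖ < (γ j.castSucc - ρ j) / Bbar) →
        (∀ j, (∃ n, S.IsClean τ δ T n j) ∧
          ∀ n, S.IsClean τ δ T n j → Tendsto (K n) atTop (𝓝 (Kstar j))) ∧
        ∀ t, 0 ≤ t →
          euclNorm (ξ t - ξr (activeMode T t))
            ≤ c₁ * Real.exp (-α * t) * euclNorm (ξ 0 - ξr (activeMode T 0)) + c₂ := by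
  have hform : ∀ j x, x ⬝ᵥ (modes j).closedLoop (Kstar j) *ᵥ x ≤ -γ j * (x ⬝ᵥ x) := fun j x => by
    refine (dotProduct_mulVec_le_logNorm _ x).trans
      (mul_le_mul_of_nonneg_right (hmargin j) ?_)
    rw [← euclNorm_sq]; positivity
  set w := Finset.univ.inf' Finset.univ_nonempty ω with hw_def
  have hw : 0 < w := (Finset.lt_inf'_iff _).2 fun j _ => hω j
  have hww : ∀ j, w ≤ ω j := fun j => Finset.inf'_le _ (Finset.mem_univ j)
  -- The required accuracy: half of the contraction rate survives, and the next mode is stabilized.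
  have hη : ∀ j, ∃ η > 0, ‖(modes j).B‖ * η ≤ γ j / 2 ∧
      ∀ i : Fin J, i.castSucc = j → η ≤ (γ j - ρ i) / Bbar := by
    intro j
    have hb : 0 < γ j / (2 * (‖(modes j).B‖ + 1)) := div_pos (hγ j) (by positivity)
    have hb2 : ‖(modes j).B‖ * (γ j / (2 * (‖(modes j).B‖ + 1))) ≤ γ j / 2 := by
      rw [mul_div_assoc', div_le_div_iff₀ (by positivity) (by norm_num)]
      nlinarith [hγ j, norm_nonneg (modes j).B]
    by_cases hj : ∃ i : Fin J, i.castSucc = j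
    · obtain ⟨i, rfl⟩ := hj
      refine ⟨min (γ i.castSucc / (2 * (‖(modes i.castSucc).B‖ + 1)))
        ((γ i.castSucc - ρ i) / Bbar), lt_min hb (div_pos (sub_pos.2 (hργ i)) hBbar),
        le_trans (mul_le_mul_of_nonneg_left (min_le_left _ _) (norm_nonneg _)) hb2, ?_⟩
      intro i' hi'
      rw [Fin.castSucc_injective _ hi']
      exact min_le_right _ _
    · exact ⟨_, hb, hb2, fun i hi => absurd ⟨i, hi⟩ hj⟩
  choose η hη0 hηB hηr using hη
  have htol : ∀ j, ∃ ε₀ > 0, IsTolerance (modes j) Q R (Kstar j) ε₀ (η j) := fun j => by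
    obtain ⟨ε₀, h0, h⟩ := exists_tolerance hQ hR (hPstar j) (hγ j)
      (fun x => by rw [← hKstar j]; exact hform j x) (hη0 j)
    rw [← hKstar j] at h
    exact ⟨ε₀, h0, h⟩
  choose ε₀ hε₀ htol using htol
  -- Bounds, uniform in the mode, for the gains and for the constants of the estimates.
  obtain ⟨C₁, hC₁⟩ := Finite.exists_le fun j => η j + ‖Kstar j‖
  obtain ⟨C₂, hC₂⟩ := Finite.exists_le fun j : Fin J =>
    (γ j.castSucc - ρ j) / Bbar + ‖Kstar j.castSucc‖
  obtain ⟨C₃, hC₃⟩ := Finite.exists_le fun j => ‖Kstar j‖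
  set κ := max ‖K₀‖ (max C₁ C₂) + C₃ with hκ_def
  have hκ : 0 ≤ κ := add_nonneg (le_max_of_le_left (norm_nonneg _))
    ((norm_nonneg _).trans (hC₃ 0))
  obtain ⟨G, hG⟩ := Finite.exists_le fun j => ‖(modes j).B‖ * κ
  have hG0 : 0 ≤ G := le_trans (by positivity) (hG 0)
  obtain ⟨N, hN⟩ := Finite.exists_le fun j =>
    ‖(modes j).B‖ * (κ * euclNorm (ξr j) + |ebar|)
  have hN0 : 0 ≤ N := le_trans
    (mul_nonneg (norm_nonneg _) (add_nonneg (mul_nonneg hκ (euclNorm_nonneg _)) (abs_nonneg _)))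
    (hN 0)
  set α := Finset.univ.inf' Finset.univ_nonempty γ / 2 with hα_def
  have hα : 0 < α := half_pos ((Finset.lt_inf'_iff _).2 fun j _ => hγ j)
  have hαγ : ∀ j, α ≤ γ j / 2 := fun j => by
    rw [hα_def]
    have := Finset.inf'_le γ (Finset.mem_univ j)
    linarith
  -- The transient after a switch lasts at most `L`; the maximum only ensures `0 ≤ L` also when no
  -- timetable is compatible with `ζmax`.
  set L := max (τ + ΔT + 2 * ζmax) 0 with hL_def
  have hL0 : 0 ≤ L := le_max_right _ _
  set M := Real.exp ((G + 1 / 2) * L) * Real.exp (α / 2 * L) with hM_def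
  have hM1 : 1 ≤ M := by
    rw [hM_def, ← Real.exp_add]
    exact Real.one_le_exp (by positivity)
  set N' := Real.exp ((G + 1 / 2) * L) * N + N / α with hN'_def
  have hN'0 : 0 ≤ N' := by positivity
  refine ⟨Finset.univ.inf' Finset.univ_nonempty ε₀, (Finset.lt_inf'_iff _).2 fun j _ => hε₀ j,
    M ^ (J + 1), by positivity, (J + 1) * M ^ J * (N' + Δr), by positivity, α / 2, half_pos hα, ?_⟩
  intro ε hε hεle T hT0 hTgap S hS e he hbd ξ u P K hrun hrank hmixed
  have hT : HasDwellTime T w := ⟨hT0, fun j => (hww _).trans (hTgap j)⟩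
  have htolε : ∀ j, IsTolerance (modes j) Q R (Kstar j) ε (η j) := fun j =>
    (htol j).mono (hεle.trans (Finset.inf'_le _ (Finset.mem_univ j)))
  have hcert := hrun.certificate_of_isClean hQ hR hS hτ hδ hΔT hw hT hdelay he hbd hrank hε
    hK₀.hasLyapunovCertificate htolε (r := fun j => (γ j.castSucc - ρ j) / Bbar)
    (fun j => hηr _ j rfl)
    (fun j _ hG => hasLyapunovCertificate_of_margin hBbar (hform _) (hpert j) (hB j) hG) hmixed
  have hclean : ∀ n j, S.IsClean τ δ T n j →
      (∀ k, HasLyapunovCertificate ((modes j).closedLoop (K n k))) ∧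
        ∀ k, IsPolicyStep (modes j) Q R (K n k) (P n k) (K n (k + 1)) := fun n j hc =>
    hrun.isPolicyStep_of_isClean hQ hR hS hτ hδ hΔT hw hT he hbd (hrank n) hc (hcert n j hc)
  have hhand : ∀ n j, S.IsClean τ δ T n j → ‖K (n + 1) 0 - Kstar j‖ < η j := fun n j hc =>
    hrun.handover_near hQ hR hε (htolε j) (hclean n j hc).1 (hclean n j hc).2
  refine ⟨fun j => ⟨hS.exists_isClean hδ hΔT hw hT hdelay j, fun n hc => ?_⟩, ?_⟩
  · rw [hKstar j]
    exact tendsto_gain hQ hR (hPstar j) (hγ j) (fun x => by rw [← hKstar j]; exact hform j x)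
      (hclean n j hc).1 (hclean n j hc).2
  -- Every phase is clean or mixed, so every gain that is applied obeys one of the three bounds.
  have hgain : ∀ n j, ‖K n 0 - Kstar j‖ ≤ κ := by
    intro n j
    have h1 : ‖K n 0‖ ≤ max ‖K₀‖ (max C₁ C₂) := by
      rcases n with _ | n
      · rw [hrun.initial_gain]; exact le_max_left _ _
      · rcases hS.isClean_or_isMixed hδ hΔT hT n with ⟨i, hi⟩ | ⟨i, hi⟩
        · have h2 := hhand n i hi
          have h3 := norm_le_norm_sub_add (K (n + 1) 0) (Kstar i)
          have h4 := hC₁ i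
          exact le_max_of_le_right (le_max_of_le_left (by linarith))
        · have h2 := hmixed n i hi
          have h3 := norm_le_norm_sub_add (K (n + 1) 0) (Kstar i.castSucc)
          have h4 := hC₂ i
          exact le_max_of_le_right (le_max_of_le_right (by linarith))
    exact (norm_sub_le _ _).trans (add_le_add h1 (hC₃ j))
  have hstate := le_of_mode_estimates (v := fun j t => euclNorm (ξ t - ξr j)) (M := M) (N := N')
    (Δ := Δr) (β := α / 2) hw hT hM1 hN'0 hΔr (half_pos hα).le ?_ ?_
  · intro t ht
    set j := activeMode T t with hj
    have h1 := hstate j t (apply_activeMode_le (by rw [hT0]; exact ht))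
      fun i hi => (lt_of_activeMode_lt hi).le
    have h2 : activeMode T 0 = 0 := activeMode_eq hT0.le fun i hi => by
      rw [← hT0]; exact hT.strictMono hw hi
    have h3 : (j : ℕ) ≤ J := Nat.lt_succ_iff.1 j.isLt
    have hv0 := euclNorm_nonneg (ξ 0 - ξr 0)
    rw [h2]
    refine h1.trans ?_
    gcongr
  · intro j t
    have : ξ t - ξr j.succ = (ξ t - ξr j.castSucc) + (ξr j.castSucc - ξr j.succ) := by abel
    rw [this]
    exact (euclNorm_add_le _ _).trans (add_le_add le_rfl (hjump j))
  · intro j b hb hbi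
    have hTj := hT.nonneg hw j
    have hmode : ∀ t ∈ Set.Ico (T j) b, activeMode T t = j := fun t ht =>
      activeMode_eq ht.1 fun i hi => ht.2.trans_le (hbi i hi)
    have hfb : ∀ t ∈ Set.Ico (T j) b, ∃ n, t < S.finishes δ n ∧
        (∀ k, n = k + 1 → S.finishes δ k ≤ t) ∧
        ∃ v, euclNorm v ≤ |ebar| ∧ u t = -(K n 0 *ᵥ ξ t) + v := fun t ht => by
      obtain ⟨n, h1, h2, v, h3, h4⟩ := hrun.exists_feedback hS hδ hΔT hbd (hTj.trans ht.1)
      exact ⟨n, h1, h2, v, h3.trans (le_abs_self _), h4⟩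
    have hoff : ∀ {κ' : ℝ}, κ' ≤ κ →
        ‖(modes j).B‖ * (κ' * euclNorm (ξr j) + |ebar|) ≤ N := fun hle => by
      refine le_trans ?_ (hN j)
      have := euclNorm_nonneg (ξr j)
      gcongr
    refine euclNorm_le_of_transient (x := fun t => ξ t - ξr j)
      (F := fun t => (modes j).A *ᵥ ξ t + (modes j).B *ᵥ u t + (modes j).d)
      hα hG0 hN0 hL0 ?_ ?_ ?_ ?_ hb
    · exact (hrun.continuousOn.mono fun t ht => hTj.trans ht.1).sub continuousOn_const
    · intro t ht
      have := hrun.dynamics t (hTj.trans ht.1)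
      rw [hmode t ht] at this
      exact this.sub_const _
    · intro t ht
      obtain ⟨n, -, -, v, hv, hu⟩ := hfb t ht
      have h1 := dotProduct_closedLoop_le (x := ξ t) (hξr j) (hform j) (hgain n j) hv
      rw [hu]
      refine h1.trans (add_le_add (mul_le_mul_of_nonneg_right ?_ (sq_nonneg _))
        (mul_le_mul_of_nonneg_right (hoff le_rfl) (euclNorm_nonneg _)))
      linarith [hG j, hγ j]
    · intro t ht hlate
      obtain ⟨n, hn, hprev, v, hv, hu⟩ := hfb t ht
      have hlate' : T j + (τ + ΔT + 2 * ζmax) ≤ t := by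
        linarith [le_max_left (τ + ΔT + 2 * ζmax) 0]
      -- Phase `0` ends by time `τ + ζmax`, so a later phase is in charge.
      obtain ⟨k, rfl⟩ : ∃ k, n = k + 1 := by
        rcases n with _ | k
        · have h2 := hS.duration_le 0
          have h3 := hS.begins_add_le 0
          rw [hS.first] at h2 h3
          linarith
        · exact ⟨k, rfl⟩
      have hc : S.IsClean τ δ T k j := hS.isClean_of_late hlate'
        (fun i hi => ht.2.trans_le (hbi i hi)) hn (hprev k rfl)
      have hd := hhand k j hc
      have h1 := dotProduct_closedLoop_le (K := K (k + 1) 0) (x := ξ t) (hξr j) (hform j) le_rfl hv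
      rw [hu]
      refine h1.trans (add_le_add (mul_le_mul_of_nonneg_right ?_ (sq_nonneg _))
        (mul_le_mul_of_nonneg_right (hoff (hgain _ j)) (euclNorm_nonneg _)))
      have h4 := mul_le_mul_of_nonneg_left hd.le (norm_nonneg (modes j).B)
      linarith [hηB j, hαγ j]
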